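/- All complexes below are abstract simplicial complexes with vertices in $\mathbb N$. The starring $(A\;a)K$ of a complex $K$ at a simplex $A\in K$ with new vertex $a\notin K$ is obtained by replacing the closed star $A\star \mathrm{lk}(A,K)$ by $a\star\partial A\star \mathrm{lk}(A,K)$; a weld is the inverse operation. Two complexes are stellar equivalent if they are related by a finite sequence of starrings, welds and renumberings of the vertices. A stellar $n$-ball (stellar $n$-sphere) is a complex stellar equivalent to the $n$-simplex (to the boundary of the $(n+1)$-simplex). A stellar $3$-manifold is a complex in which the link of each vertex is a stellar $2$-ball or a stellar $2$-sphere. The generators of a complex are its maximal simplices; a complex with finitely many generators is closed if the sum modulo $2$ of the boundaries of its generators is $0$. Let $S$ be a complex and $\simeq$ an equivalence relation on its vertices. Distinct generators $g\ne p$ of $S$ are called equivalent, $g\simeq p$, if each vertex of $g$ is equal or equivalent to some vertex of $p$. The relation $\simeq$ is called regular if (i) no generator of $S$ has two distinct equivalent vertices, and (ii) for each generator $g$ there is at most one generator $p\neq g$ with $g\simeq p$. For regular $\simeq$, let $S/\simeq$ be the simplicial complex whose vertices are the classes and whose simplices are the images of the simplices of $S$, and let $a\star(S/\simeq)$ be the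 generalized complex obtained from the cone $a\star S$ ($a\notin S$) by replacing its base $S$ by $S/\simeq$: its faces are the simplices of $S/\simeq$ and the simplices $a\star\sigma$ ($\sigma\in S$ or $\sigma=\emptyset$), which are not identified with one another; the faces of $a\star\sigma$ are the $a\star\sigma'$ with $\sigma'\subseteq\sigma$ and the faces of the image of $\sigma$ in $S/\simeq$. Here a generalized complex is a simplicial poset: a poset with least element (the empty face) in which every lower interval is the lattice of subsets of a finite set; a simplicial complex is one through its face poset. The starring of a generalized complex at a nonempty face $A$ has as faces the faces $\tau\not\ge A$ and, for each pair $(\tau,\sigma)$ with $\tau\not\ge A$ and $\sigma$ a minimal upper bound of $\tau$ and $A$, a face $a\star_\sigma\tau$; one has $\tau'\le a\star_\sigma\tau$ iff $\tau'\le\tau$, and $a\star_{\sigma'}\tau'\le a\star_\sigma\tau$ iff $\tau'\le\tau$ and $\sigma'\le\sigma$. For face posets of simplicial complexes this is the starring above. Two generalized complexes are stellar equivalent if they are related by a finite sequence of starrings, their inverses and isomorphisms. **Theorem.** Let $M$ be a connected (nonempty) stellar $3$-manifold with finitely many generators. Then there are a stellar $2$-sphere $S$, a vertex $a\notin S$ and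 a regular equivalence relation $\simeq$ on the vertices of $S$ such that $M$ is stellar equivalent, as a generalized complex, to $N=a\star(S/\simeq)$, and moreover, if $M$ is closed, then for each generator $g$ of $S$ there is exactly one generator $p\neq g$ of $S$ with $g\simeq p$. -/

import Mathlib

/-- A complex: a simplicial complex whose vertices are natural numbers.  A simplex is the
(nonempty, finite) set of its vertices. -/
abbrev Cplx := PreAbstractSimplicialComplex ℕ

namespace Cplx

/-- The set of vertices of a complex. -/
def vertices (K : Cplx) : Set ℕ := {v | {v} ∈ K.faces}

/-- The generators of a complex: its maximal simplices. -/
def generators (K : Cplx) : Set (Finset ℕ) := {g | Maximal (fun s => s ∈ K.faces) g}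

/-- The boundary `∂ K` with coefficients in `ℤ/2`: the sum over all generators `g` of `K` of the
sum of all faces of `g` of codimension one. (Used for complexes with finitely many generators.) -/
noncomputable def boundary (K : Cplx) : Finset ℕ →₀ ZMod 2 :=
  ∑ᶠ g ∈ K.generators, ∑ i ∈ g, Finsupp.single (g.erase i) 1

/-- A complex is closed if `∂ K = 0`. -/
def Closed (K : Cplx) : Prop := K.boundary = 0

/-- A complex is connected if it is nonempty and any two vertices are joined by an edge path. -/
def Connected (K : Cplx) : Prop :=
  K.vertices.Nonempty ∧
    ∀ u ∈ K.vertices, ∀ v ∈ K.vertices,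
      Relation.ReflTransGen (fun x y => ({x, y} : Finset ℕ) ∈ K.faces) u v

/-- The link of `A` in `K`: all simplices `B` disjoint from `A` with `A ⋆ B ∈ K`. -/
def link (A : Finset ℕ) (K : Cplx) : Cplx where
  faces := {B | B.Nonempty ∧ Disjoint A B ∧ A ∪ B ∈ K.faces}
  isRelLowerSet_faces := by
    rintro B ⟨hB, hd, hK⟩
    refine ⟨hB, fun C hCB hC => ⟨hC, hd.mono_right hCB, ?_⟩⟩
    exact (K.isRelLowerSet_faces hK).2 (Finset.union_subset_union_right hCB)
      (hC.mono Finset.subset_union_right)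

/-- The starring `(A a) K = a ⋆ ∂A ⋆ lk(A, K) + Q(A, K)` of `K` at `a` (meant for a simplex
`A ∈ K` and an `a` that is not a vertex of `K`).  Its simplices are those of `K` that do not
contain `A`, and the simplices `a ⋆ ρ` with `ρ ∈ ∂A ⋆ lk(A, K)` (or `ρ` empty), that is
`A ⊄ ρ` and `A ∪ ρ ∈ K`. -/
def subdivide (A : Finset ℕ) (a : ℕ) (K : Cplx) : Cplx where
  faces := {s | s ∈ K.faces ∧ ¬ A ⊆ s} ∪
    {s | a ∈ s ∧ ¬ A ⊆ s.erase a ∧ A ∪ s.erase a ∈ K.faces}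
  isRelLowerSet_faces := by
    rintro s (⟨hs, hA⟩ | ⟨has, hA, hs⟩)
    · exact ⟨(K.isRelLowerSet_faces hs).1, fun t hts ht =>
        Or.inl ⟨(K.isRelLowerSet_faces hs).2 hts ht, fun h => hA (h.trans hts)⟩⟩
    · refine ⟨⟨a, has⟩, fun t hts ht => ?_⟩
      have hts' : t.erase a ⊆ s.erase a := Finset.erase_subset_erase a hts
      by_cases hat : a ∈ t
      · refine Or.inr ⟨hat, fun h => hA (h.trans hts'), ?_⟩
        refine (K.isRelLowerSet_faces hs).2 (Finset.union_subset_union_right hts') ?_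
        have : A.Nonempty := by
          rw [Finset.nonempty_iff_ne_empty]
          rintro rfl
          exact hA (Finset.empty_subset _)
        exact this.mono Finset.subset_union_left
      · rw [Finset.erase_eq_of_notMem hat] at hts'
        exact Or.inl ⟨(K.isRelLowerSet_faces hs).2 (hts'.trans Finset.subset_union_right) ht,
          fun h => hA (h.trans hts')⟩

/-- The stellar moves: subdivision, weld (the inverse of a subdivision), and change of the
enumeration of the vertices. -/
inductive StellarMove : Cplx → Cplx → Prop
  | subdivision (K : Cplx) (A : Finset ℕ) (a : ℕ) (hA : A ∈ K.faces) (ha : a ∉ K.vertices) :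
      StellarMove K (subdivide A a K)
  | weld (K : Cplx) (A : Finset ℕ) (a : ℕ) (hA : A ∈ K.faces) (ha : a ∉ K.vertices) :
      StellarMove (subdivide A a K) K
  | renumber (K : Cplx) (f : ℕ → ℕ) (hf : Set.InjOn f K.vertices) :
      StellarMove K (K.map f)

/-- Stellar equivalence of complexes: a finite sequence of stellar moves. -/
def StellarEquiv : Cplx → Cplx → Prop := Relation.ReflTransGen StellarMove

/-- The `n`-simplex with vertices `0, …, n`, with all its faces. -/
def simplex (n : ℕ) : Cplx where
  faces := {s | s.Nonempty ∧ s ⊆ Finset.range (n + 1)}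
  isRelLowerSet_faces := fun _ hs => ⟨hs.1, fun _ hts ht => ⟨ht, hts.trans hs.2⟩⟩

/-- The boundary complex of the `(n+1)`-simplex with vertices `0, …, n + 1`. -/
def simplexBoundary (n : ℕ) : Cplx where
  faces := {s | s.Nonempty ∧ s ⊂ Finset.range (n + 2)}
  isRelLowerSet_faces := fun _ hs =>
    ⟨hs.1, fun _ hts ht => ⟨ht, lt_of_le_of_lt hts hs.2⟩⟩

/-- A stellar `n`-ball. -/
def IsStellarBall (n : ℕ) (K : Cplx) : Prop := StellarEquiv K (simplex n)

/-- A stellar `n`-sphere. -/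
def IsStellarSphere (n : ℕ) (K : Cplx) : Prop := StellarEquiv K (simplexBoundary n)

/-- A stellar `3`-manifold: all vertex links are stellar `2`-balls or stellar `2`-spheres. -/
def IsStellarThreeManifold (M : Cplx) : Prop :=
  ∀ v ∈ M.vertices, IsStellarBall 2 (link {v} M) ∨ IsStellarSphere 2 (link {v} M)

/-- Two distinct generators `g ≠ p` are equivalent if every vertex of `g` is equal or equivalent
to some vertex of `p`. -/
def GenEquiv (r : Setoid ℕ) (g p : Finset ℕ) : Prop := p ≠ g ∧ ∀ v ∈ g, ∃ w ∈ p, r v w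

/-- A regular equivalence relation on the vertices of `S`. (Every equivalence relation on the
vertices extends to one on `ℕ`, and only its restriction to the vertices of `S` is used.) -/
structure Regular (S : Cplx) (r : Setoid ℕ) : Prop where
  eq_of_rel : ∀ g ∈ S.generators, ∀ u ∈ g, ∀ v ∈ g, r u v → u = v
  unique : ∀ g ∈ S.generators, ∀ p ∈ S.generators, ∀ q ∈ S.generators,
    GenEquiv r g p → GenEquiv r g q → p = q

/-- The cone `a ⋆ S` (meant for an `a` that is not a vertex of `S`). -/
def cone (a : ℕ) (S : Cplx) : Cplx where
  faces := {s | s.Nonempty ∧ (s.erase a = ∅ ∨ s.erase a ∈ S.faces)}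
  isRelLowerSet_faces := by
    rintro s ⟨hs, h⟩
    refine ⟨hs, fun t hts ht => ⟨ht, ?_⟩⟩
    have hts' : t.erase a ⊆ s.erase a := Finset.erase_subset_erase a hts
    rcases (t.erase a).eq_empty_or_nonempty with h0 | h0
    · exact Or.inl h0
    · rcases h with h | h
      · rw [h] at hts'
        exact Or.inl (Finset.subset_empty.1 hts')
      · exact Or.inr ((S.isRelLowerSet_faces h).2 hts' h0)

open Classical in
/-- The quotient complex `S/≃`: its vertices are classes of vertices of `S`, its simplices the
images of the simplices of `S`. -/
noncomputable def quotient (S : Cplx) (r : Setoid ℕ) :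
    PreAbstractSimplicialComplex (Quotient r) :=
  PreAbstractSimplicialComplex.map S (Quotient.mk r)

theorem finite_iff (K : Cplx) : K.faces.Finite ↔ K.vertices.Finite := by
  constructor
  · intro h
    exact Set.Finite.preimage (f := fun v : ℕ => ({v} : Finset ℕ))
      (fun _ _ _ _ h => Finset.singleton_injective h) h
  · intro h
    refine (Finset.finite_toSet h.toFinset.powerset).subset fun s hs => ?_
    refine Finset.mem_coe.2 (Finset.mem_powerset.2 fun v hv => h.mem_toFinset.2 ?_)
    exact (K.isRelLowerSet_faces hs).2 (Finset.singleton_subset_iff.2 hv)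
      (Finset.singleton_nonempty v)

theorem StellarMove.finite_of_finite {K L : Cplx} (h : StellarMove K L) (hL : L.faces.Finite) :
    K.faces.Finite := by
  rw [finite_iff] at hL ⊢
  cases h with
  | subdivision _ A a hA ha =>
    refine (hL.union A.finite_toSet).subset fun v hv => ?_
    by_cases hvA : v ∈ A
    · exact Or.inr hvA
    · refine Or.inl (Or.inl ⟨hv, fun h => ?_⟩)
      obtain ⟨w, hw⟩ := (K.isRelLowerSet_faces hA).1
      have := Finset.mem_singleton.1 (h hw)
      exact hvA (this ▸ hw)
  | weld _ A a hA ha =>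
    refine (hL.union (Set.finite_singleton a)).subset fun v hv => ?_
    rcases hv with hv | hv
    · exact Or.inl hv.1
    · exact Or.inr (Finset.mem_singleton.1 hv.1).symm
  | renumber _ f hf =>
    refine Set.Finite.of_finite_image (f := f) (hL.subset ?_) hf
    rintro _ ⟨v, hv, rfl⟩
    exact ⟨{v}, hv, by simp⟩

theorem IsStellarSphere.finite {n : ℕ} {K : Cplx} (h : IsStellarSphere n K) :
    K.faces.Finite := by
  have h' : Relation.ReflTransGen StellarMove K (simplexBoundary n) := h
  induction h' using Relation.ReflTransGen.head_induction_on with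
  | refl =>
    refine (Finset.finite_toSet (Finset.range (n + 2)).powerset).subset fun s hs => ?_
    exact Finset.mem_coe.2 (Finset.mem_powerset.2 hs.2.subset)
  | head hm ht ih => exact hm.finite_of_finite (ih ht)

theorem Regular.injOn {S : Cplx} {r : Setoid ℕ} (hr : Regular S r) (hS : S.faces.Finite)
    (s : Finset ℕ) (hs : s ∈ S.faces) : Set.InjOn (Quotient.mk r) (s : Set ℕ) := by
  obtain ⟨g, hsg, hg⟩ := hS.exists_le_maximal hs
  intro u hu v hv h
  exact hr.eq_of_rel g hg u (hsg hu) v (hsg hv) (Quotient.exact h)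

end Cplx

/-- A generalized simplicial complex, given by its face poset (a simplicial poset): a partially
ordered set with a least element (the empty face) in which the faces below any face form the
lattice of all subsets of a finite set (the vertices of that face).  Unlike in a simplicial
complex, different faces may have the same vertices. -/
structure SimplicialPoset where
  Face : Type
  [order : PartialOrder Face]
  [bot : OrderBot Face]
  boolean : ∀ x : Face, ∃ s : Finset ℕ, Nonempty (Set.Iic s ≃o Set.Iic x)

attribute [instance] SimplicialPoset.order SimplicialPoset.bot

namespace SimplicialPoset

/-- The face poset of the starring of `P` at a nonempty face `A`.  A pair `(τ, ⊥)` stands for a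
face `τ` of `P` that does not contain `A`.  A pair `(τ, σ)` stands for the face `a ⋆ τ`, where `a`
is the new vertex and `τ` is a face of the face `σ`, not containing `A`, such that `τ` and `A`
together span `σ`; that is, `τ = α ⋆ β` with `α ∈ ∂A` and `σ = A ⋆ β`, so `β` in the link of `A`.
In a generalized complex `a ⋆ τ` depends on the simplex `σ` in which it lies and not only on `τ`.
The order is the componentwise one. -/
def Starring (P : SimplicialPoset) (A : P.Face) : Type :=
  {x : P.Face × WithBot P.Face //
    ¬ A ≤ x.1 ∧ ∀ σ : P.Face, x.2 = (σ : WithBot P.Face) →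
      Minimal (fun ρ => x.1 ≤ ρ ∧ A ≤ ρ) σ}

instance (P : SimplicialPoset) (A : P.Face) : PartialOrder (P.Starring A) :=
  inferInstanceAs (PartialOrder {x : P.Face × WithBot P.Face //
    ¬ A ≤ x.1 ∧ ∀ σ : P.Face, x.2 = (σ : WithBot P.Face) →
      Minimal (fun ρ => x.1 ≤ ρ ∧ A ≤ ρ) σ})

/-- The stellar moves of generalized complexes: subdivision, weld, and renaming of the faces. -/
inductive StellarMove (P Q : SimplicialPoset) : Prop
  | subdivision (A : P.Face) (hA : A ≠ ⊥) (e : P.Starring A ≃o Q.Face)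
  | weld (A : Q.Face) (hA : A ≠ ⊥) (e : Q.Starring A ≃o P.Face)
  | rename (e : P.Face ≃o Q.Face)

/-- Stellar equivalence of generalized complexes: a finite sequence of stellar moves. -/
def StellarEquiv : SimplicialPoset → SimplicialPoset → Prop := Relation.ReflTransGen StellarMove

end SimplicialPoset

namespace Cplx

/-- A complex as a generalized complex: all its simplices and the empty face, ordered by
inclusion. -/
def facePoset (K : Cplx) : SimplicialPoset where
  Face := {s : Finset ℕ // s = ∅ ∨ s ∈ K.faces}
  bot := { bot := ⟨∅, Or.inl rfl⟩, bot_le := fun s => Finset.empty_subset s.1 }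
  boolean := by
    rintro ⟨s, hs⟩
    have key : ∀ t ⊆ s, t = ∅ ∨ t ∈ K.faces := by
      intro t ht
      rcases t.eq_empty_or_nonempty with h | h
      · exact Or.inl h
      · rcases hs with rfl | hs
        · exact Or.inl (Finset.subset_empty.1 ht)
        · exact Or.inr ((K.isRelLowerSet_faces hs).2 ht h)
    exact ⟨s, ⟨{
      toFun := fun t => ⟨⟨t.1, key t.1 t.2⟩, t.2⟩
      invFun := fun t => ⟨t.1.1, t.2⟩
      left_inv := fun _ => rfl
      right_inv := fun _ => rfl
      map_rel_iff' := Iff.rfl }⟩⟩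

open Classical in
/-- The faces of `a ⋆ (S/≃)`, understood as the cone `a ⋆ S` whose base `S` is replaced by `S/≃`:
a pair `(τ, ∅)` stands for a simplex `τ` of `S/≃` (or the empty face), and a pair `(τ, ρ)` with
`ρ` nonempty stands for a simplex `ρ = a ⋆ σ` of `a ⋆ S` that contains `a`, where `τ` is the image
in `S/≃` of the face `σ` of `ρ` opposite to `a`. The order is the componentwise one: the faces of
`a ⋆ σ` are all `a ⋆ σ'` with `σ' ⊆ σ`, and all faces of the image of `σ`. -/
def IsConeFace (S : Cplx) (a : ℕ) (r : Setoid ℕ) (x : Finset (Quotient r) × Finset ℕ) : Prop :=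
  ((x.1 = ∅ ∨ x.1 ∈ (S.quotient r).faces) ∧ x.2 = ∅) ∨
    (x.2 ∈ (cone a S).faces ∧ a ∈ x.2 ∧ x.1 = (x.2.erase a).image (Quotient.mk r))

open Classical in
theorem coneQuotient_boolean (S : Cplx) (a : ℕ) (r : Setoid ℕ) (ha : a ∉ S.vertices)
    (hr : ∀ s ∈ S.faces, Set.InjOn (Quotient.mk r) (s : Set ℕ))
    (x : {x : Finset (Quotient r) × Finset ℕ // IsConeFace S a r x}) :
    ∃ s : Finset ℕ, Nonempty (Set.Iic s ≃o Set.Iic x) := by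
  let φ : Finset ℕ → Finset (Quotient r) × Finset ℕ := fun t =>
    ((t.erase a).image (Quotient.mk r), if a ∈ t then t else ∅)
  have hφ : ∀ t : Finset ℕ, (t.erase a = ∅ ∨ t.erase a ∈ S.faces) → IsConeFace S a r (φ t) := by
    intro t ht
    by_cases hat : a ∈ t
    · refine Or.inr ⟨?_, ?_, ?_⟩ <;> simp only [φ, if_pos hat]
      · exact ⟨⟨a, hat⟩, ht⟩
      · exact hat
    · refine Or.inl ⟨?_, by simp only [φ, if_neg hat]⟩
      rcases ht with ht | ht
      · exact Or.inl (by simp only [φ, ht, Finset.image_empty])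
      · exact Or.inr ⟨t.erase a, ht, rfl⟩
  obtain ⟨s, hs, hx⟩ : ∃ s : Finset ℕ, (s.erase a = ∅ ∨ s.erase a ∈ S.faces) ∧ x.1 = φ s := by
    obtain ⟨⟨τ, ρ⟩, h⟩ := x
    rcases h with ⟨h1, h2⟩ | ⟨h1, h2, h3⟩
    · obtain rfl : ρ = ∅ := h2
      rcases h1 with h1 | ⟨σ, hσ, h1⟩
      · obtain rfl : τ = ∅ := h1
        exact ⟨∅, by simp, by simp [φ]⟩
      · have haσ : a ∉ σ := fun h => ha
          ((S.isRelLowerSet_faces hσ).2 (Finset.singleton_subset_iff.2 h) ⟨a, by simp⟩)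
        refine ⟨σ, Or.inr (by rwa [Finset.erase_eq_of_notMem haσ]), ?_⟩
        simp only [φ, Finset.erase_eq_of_notMem haσ, if_neg haσ]
        exact Prod.ext (by rw [← h1]) rfl
    · exact ⟨ρ, h1.2, Prod.ext h3 (by simp only [φ]; rw [if_pos h2])⟩
  have hsub : ∀ t : Finset ℕ, t ⊆ s → (t.erase a = ∅ ∨ t.erase a ∈ S.faces) := by
    intro t hts
    have hts' : t.erase a ⊆ s.erase a := Finset.erase_subset_erase a hts
    rcases (t.erase a).eq_empty_or_nonempty with h0 | h0
    · exact Or.inl h0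
    · rcases hs with h | h
      · rw [h] at hts'
        exact Or.inl (Finset.subset_empty.1 hts')
      · exact Or.inr ((S.isRelLowerSet_faces h).2 hts' h0)
  have hinj : Set.InjOn (Quotient.mk r) (s.erase a : Set ℕ) := by
    rcases hs with h | h
    · rw [h]; simp
    · exact hr _ h
  have hle : ∀ t ⊆ s, ∀ t' ⊆ s, (φ t ≤ φ t' ↔ t ⊆ t') := by
    intro t hts t' hts'
    constructor
    · rintro ⟨h1, h2⟩ v hv
      by_cases hva : v = a
      · subst hva
        simp only [φ, if_pos hv] at h2
        by_contra hat
        rw [if_neg hat] at h2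
        exact absurd (h2 hv) (Finset.notMem_empty _)
      · have hv' : v ∈ t.erase a := Finset.mem_erase.2 ⟨hva, hv⟩
        obtain ⟨w, hw, hwv⟩ := Finset.mem_image.1 (h1 (Finset.mem_image_of_mem _ hv'))
        have := hinj (Finset.erase_subset_erase a hts' hw) (Finset.erase_subset_erase a hts hv') hwv
        exact this ▸ Finset.mem_of_mem_erase hw
    · intro h
      refine ⟨Finset.image_subset_image (Finset.erase_subset_erase a h), ?_⟩
      by_cases hat : a ∈ t
      · simp only [φ, if_pos hat, if_pos (h hat)]
        exact h
      · simp only [φ, if_neg hat]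
        exact Finset.empty_subset _
  let ψ : Set.Iic s → Set.Iic x := fun t =>
    ⟨⟨φ t.1, hφ _ (hsub _ t.2)⟩, by
      change φ t.1 ≤ x.1
      rw [hx]
      exact (hle _ t.2 _ subset_rfl).2 t.2⟩
  have hψ : ∀ t t', ψ t ≤ ψ t' ↔ t ≤ t' := fun t t' => hle _ t.2 _ t'.2
  have hsurj : Function.Surjective ψ := by
    rintro ⟨⟨⟨τ, ρ⟩, h⟩, hyx⟩
    have hy : (τ, ρ) ≤ φ s := by rw [← hx]; exact hyx
    obtain ⟨hy1, hy2⟩ := hy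
    suffices ∃ t ⊆ s, φ t = (τ, ρ) by
      obtain ⟨t, ht, he⟩ := this
      exact ⟨⟨t, ht⟩, Subtype.ext (Subtype.ext he)⟩
    rcases h with ⟨-, h2⟩ | ⟨h1, h2, h3⟩
    · obtain rfl : ρ = ∅ := h2
      refine ⟨(s.erase a).filter (fun v => Quotient.mk r v ∈ τ),
        (Finset.filter_subset _ _).trans (Finset.erase_subset _ _), ?_⟩
      have hn : a ∉ (s.erase a).filter (fun v => Quotient.mk r v ∈ τ) := by simp
      simp only [φ, if_neg hn, Finset.erase_eq_of_notMem hn]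
      refine Prod.ext ?_ rfl
      ext q
      simp only [Finset.mem_image, Finset.mem_filter]
      constructor
      · rintro ⟨v, hv, rfl⟩
        exact hv.2
      · intro hq
        obtain ⟨v, hv, rfl⟩ := Finset.mem_image.1 (hy1 hq)
        exact ⟨v, ⟨hv, hq⟩, rfl⟩
    · refine ⟨ρ, ?_, Prod.ext h3.symm (by simp only [φ]; rw [if_pos h2])⟩
      refine Finset.Subset.trans hy2 ?_
      simp only [φ]
      split_ifs
      · exact subset_rfl
      · exact Finset.empty_subset _
  exact ⟨s, ⟨RelIso.ofSurjective
    ⟨⟨ψ, fun t t' h => le_antisymm ((hψ _ _).1 h.le) ((hψ _ _).1 h.ge)⟩, hψ _ _⟩ hsurj⟩⟩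

/-- The generalized complex `a ⋆ (S/≃)`: the cone `a ⋆ S` in which those simplices of the base `S`
are identified whose vertices are equivalent.  Simplices that contain `a` are not identified. -/
noncomputable def coneQuotient (S : Cplx) (a : ℕ) (r : Setoid ℕ) (ha : a ∉ S.vertices)
    (hr : ∀ s ∈ S.faces, Set.InjOn (Quotient.mk r) (s : Set ℕ)) : SimplicialPoset where
  Face := {x : Finset (Quotient r) × Finset ℕ // IsConeFace S a r x}
  bot := { bot := ⟨(∅, ∅), Or.inl ⟨Or.inl rfl, rfl⟩⟩
           bot_le := fun x => ⟨Finset.empty_subset x.1.1, Finset.empty_subset x.1.2⟩ }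
  boolean := coneQuotient_boolean S a r ha hr

end Cplx

/-! The cone with apex `a` swallows the tetrahedra of `M` one at a time. The intermediate object
`glued D S π` is a part `D` of `M` together with a cone over a stellar sphere `S`, attached along a
nondegenerate simplicial map `π : S → D`. Starring `M` at one tetrahedron gives such a form, with
`S` the boundary of a tetrahedron (`stellarEquiv_delete_facet`).

Suppose a tetrahedron `T = w ⋆ t` of `D` shares the triangle `t` with a tetrahedron that has been
swallowed. Then `t` is the image of exactly one triangle `σ₀` of `S`, and the only tetrahedra
through `t` in the glued complex are `w ⋆ t` and `a ⋆ σ₀`. A 2-3 move deletes `t` and replaces these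
two by three tetrahedra around a new edge from `a` to `w`. This is a stellar equivalence, since
starring the old complex at `t` and starring the new one at the new edge give the same result
(`IsFlip.stellarEquiv`). On `S` the effect is a starring at `σ₀` with a new vertex `b` labelled `π b
= w`, so `S` remains a stellar sphere; `D` loses just `t` and `T`. The label `w` may already occur
on `S`, which is why simplicial posets are needed.

The manifold hypothesis enters only through `IsPseudomanifold`: purity, strong connectedness, and at
most two facets at each ridge. These properties are carried along stellar equivalences, hold for
simplices and their boundaries, and pass from the vertex links to a connected complex. By strong
connectedness a suitable `T` exists as long as `D` contains a tetrahedron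
(`exists_isUnfolding_complete`).

At the end every simplex of `D` is an image of a simplex of `S`, so the glued complex is `a ⋆ (S/≃)`
with `≃` the kernel of `π`. Each triangle of `S` has an owner, the tetrahedron of `M` it comes from,
and triangles with the same image and the same owner are equal. A triangle of `M` lies in at most
two tetrahedra, which gives regularity; in a closed `M` it lies in exactly two, which gives the last
claim. -/

namespace Cplx

/-! ### Simplices of a starring. -/

theorem mem_of_subset {K : Cplx} {s t : Finset ℕ} (hs : s ∈ K.faces) (h : t ⊆ s)
    (ht : t.Nonempty) : t ∈ K.faces :=
  (K.isRelLowerSet_faces hs).2 h ht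

theorem nonempty_of_mem {K : Cplx} {s : Finset ℕ} (hs : s ∈ K.faces) : s.Nonempty :=
  (K.isRelLowerSet_faces hs).1

theorem mem_vertices_of_mem {K : Cplx} {s : Finset ℕ} {v : ℕ} (hs : s ∈ K.faces) (hv : v ∈ s) :
    v ∈ K.vertices :=
  mem_of_subset hs (Finset.singleton_subset_iff.2 hv) (Finset.singleton_nonempty v)

theorem notMem_of_mem_faces {K : Cplx} {s : Finset ℕ} {a : ℕ} (ha : a ∉ K.vertices)
    (hs : s ∈ K.faces) : a ∉ s :=
  fun h => ha (mem_vertices_of_mem hs h)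

theorem mem_subdivide_of_notMem {K : Cplx} {A s : Finset ℕ} {a : ℕ} (h : a ∉ s) :
    s ∈ (subdivide A a K).faces ↔ s ∈ K.faces ∧ ¬ A ⊆ s :=
  ⟨fun hs => hs.resolve_right fun h' => h h'.1, Or.inl⟩

theorem insert_mem_subdivide {K : Cplx} {A β : Finset ℕ} {a : ℕ} (ha : a ∉ K.vertices)
    (h : a ∉ β) : insert a β ∈ (subdivide A a K).faces ↔ ¬ A ⊆ β ∧ A ∪ β ∈ K.faces := by
  constructor
  · rintro (⟨h1, -⟩ | ⟨-, h1, h2⟩)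
    · exact absurd (Finset.mem_insert_self a β) (notMem_of_mem_faces ha h1)
    · rw [Finset.erase_insert h] at h1 h2
      exact ⟨h1, h2⟩
  · rintro ⟨h1, h2⟩
    refine Or.inr ⟨Finset.mem_insert_self a β, ?_⟩
    rw [Finset.erase_insert h]
    exact ⟨h1, h2⟩

/-- Exchanging a vertex of `A` for `a` is the standard way to carry a simplex over `A` into the
starring without changing its dimension. -/
theorem insert_erase_mem_subdivide {K : Cplx} {A F : Finset ℕ} {a x : ℕ} (ha : a ∉ K.vertices)
    (hF : F ∈ K.faces) (hA : A ⊆ F) (hx : x ∈ A) :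
    insert a (F.erase x) ∈ (subdivide A a K).faces := by
  have haF := notMem_of_mem_faces ha hF
  rw [insert_mem_subdivide ha fun h => haF (Finset.mem_of_mem_erase h)]
  refine ⟨fun h => Finset.notMem_erase x F (h hx), ?_⟩
  exact mem_of_subset hF (Finset.union_subset hA (Finset.erase_subset _ _))
    ⟨x, Finset.mem_union_left _ hx⟩

theorem card_insert_erase_of_mem {F : Finset ℕ} {a x : ℕ} (ha : a ∉ F) (hx : x ∈ F) :
    (insert a (F.erase x)).card = F.card := by
  rw [Finset.card_insert_of_notMem fun h => ha (Finset.mem_of_mem_erase h),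
    Finset.card_erase_add_one hx]

/-! ### Pseudomanifolds and stellar moves. -/

/-- Two `n`-simplices of `K` that share a simplex of dimension `n - 1`. -/
def Adj (n : ℕ) (K : Cplx) (F G : Finset ℕ) : Prop :=
  (F ∈ K.faces ∧ F.card = n + 1) ∧ (G ∈ K.faces ∧ G.card = n + 1) ∧ n ≤ (F ∩ G).card

/-- A pure strongly connected `n`-dimensional complex in which every simplex of dimension `n - 1`
lies in at most two simplices of dimension `n`. -/
structure IsPseudomanifold (n : ℕ) (K : Cplx) : Prop where
  nonempty : K.faces.Nonempty
  card_le : ∀ s ∈ K.faces, s.card ≤ n + 1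
  exists_facet : ∀ s ∈ K.faces, ∃ F ∈ K.faces, s ⊆ F ∧ F.card = n + 1
  ridge : ∀ ρ : Finset ℕ, ρ.card = n → ∀ F ∈ K.faces, ∀ G ∈ K.faces, ∀ H ∈ K.faces,
    F.card = n + 1 → G.card = n + 1 → H.card = n + 1 → ρ ⊆ F → ρ ⊆ G → ρ ⊆ H →
    F = G ∨ F = H ∨ G = H
  connected : ∀ F ∈ K.faces, ∀ G ∈ K.faces, F.card = n + 1 → G.card = n + 1 →
    Relation.ReflTransGen (Adj n K) F G

theorem eq_insert_erase_of_mem {a : ℕ} {s : Finset ℕ} (h : a ∈ s) :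
    ∃ β, a ∉ β ∧ s = insert a β :=
  ⟨s.erase a, Finset.notMem_erase a s, (Finset.insert_erase h).symm⟩

section Subdivide

variable {n : ℕ} {K : Cplx} {A : Finset ℕ} {a : ℕ}

/-- Under a dimension bound this forces `A ∪ β` to be a facet whenever `insert a β` is a facet of
the starring. -/
theorem card_union_gt {β : Finset ℕ} (h : ¬ A ⊆ β) : β.card + 1 ≤ (A ∪ β).card := by
  apply Finset.card_lt_card
  refine ⟨Finset.subset_union_right, fun h' => h (Finset.subset_union_left.trans h')⟩

/-- Every facet of the starring lies over a facet of the complex. -/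
theorem facet_subdivide (hc : ∀ s ∈ K.faces, s.card ≤ n + 1) (ha : a ∉ K.vertices)
    {F : Finset ℕ} (hF : F ∈ (subdivide A a K).faces) (hn : F.card = n + 1) :
    (a ∉ F ∧ F ∈ K.faces ∧ ¬ A ⊆ F) ∨
      ∃ G ∈ K.faces, G.card = n + 1 ∧ A ⊆ G ∧ ∃ x ∈ A, F = insert a (G.erase x) := by
  by_cases haF : a ∈ F
  · right
    obtain ⟨β, hβ, rfl⟩ := eq_insert_erase_of_mem haF
    obtain ⟨h1, h2⟩ := (insert_mem_subdivide ha hβ).1 hF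
    rw [Finset.card_insert_of_notMem hβ] at hn
    have h3 := card_union_gt h1
    have h4 := hc _ h2
    obtain ⟨x, hx, hxβ⟩ := Finset.not_subset.1 h1
    refine ⟨A ∪ β, h2, by omega, Finset.subset_union_left, x, hx, ?_⟩
    congr 1
    refine Finset.eq_of_subset_of_card_le (fun y hy => ?_) ?_
    · exact Finset.mem_erase.2 ⟨fun h => hxβ (h ▸ hy), Finset.mem_union_right _ hy⟩
    · rw [Finset.card_erase_of_mem (Finset.mem_union_left _ hx)]
      omega
  · exact Or.inl ⟨haF, (mem_subdivide_of_notMem haF).1 hF⟩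

/-- Facets of the starring project onto facets of `K` by exchanging `a` for all of `A`. Purity and
strong connectedness descend along this projection; it may collapse two adjacent facets to one,
which `Adj` permits. The ridge condition is pulled back instead: the facets through a ridge of `K`
inject into the facets through a ridge of the starring. -/
theorem IsPseudomanifold.of_subdivide (hA : A ∈ K.faces) (ha : a ∉ K.vertices)
    (h : IsPseudomanifold n (subdivide A a K)) : IsPseudomanifold n K := by
  obtain ⟨x, hxA⟩ := nonempty_of_mem hA
  have hc : ∀ s ∈ K.faces, s.card ≤ n + 1 := by
    intro s hs
    by_cases hAs : A ⊆ s
    · rw [← card_insert_erase_of_mem (notMem_of_mem_faces ha hs) (hAs hxA)]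
      exact h.card_le _ (insert_erase_mem_subdivide ha hs hAs hxA)
    · exact h.card_le _ (Or.inl ⟨hs, hAs⟩)
  -- the projection of facets
  let φ : Finset ℕ → Finset ℕ := fun F => if a ∈ F then A ∪ F.erase a else F
  have hφ : ∀ F ∈ (subdivide A a K).faces, F.card = n + 1 → φ F ∈ K.faces ∧ (φ F).card = n + 1 := by
    intro F hF hn
    by_cases haF : a ∈ F
    · obtain ⟨β, hβ, rfl⟩ := eq_insert_erase_of_mem haF
      obtain ⟨h1, h2⟩ := (insert_mem_subdivide ha hβ).1 hF
      have h3 := card_union_gt h1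
      rw [Finset.card_insert_of_notMem hβ] at hn
      simp only [φ, haF, if_true, Finset.erase_insert hβ]
      exact ⟨h2, le_antisymm (hc _ h2) (by omega)⟩
    · simp only [φ, haF, if_false]
      exact ⟨((mem_subdivide_of_notMem haF).1 hF).1, hn⟩
  refine ⟨⟨A, hA⟩, hc, ?_, ?_, ?_⟩
  · intro s hs
    by_cases hAs : A ⊆ s
    · obtain ⟨F, hF, hsF, hn⟩ := h.exists_facet _ (insert_erase_mem_subdivide ha hs hAs hxA)
      have haF : a ∈ F := hsF (Finset.mem_insert_self _ _)
      refine ⟨φ F, (hφ F hF hn).1, fun y hy => ?_, (hφ F hF hn).2⟩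
      simp only [φ, haF, if_true]
      by_cases hyx : y = x
      · exact Finset.mem_union_left _ (hyx ▸ hxA)
      · refine Finset.mem_union_right _ (Finset.mem_erase.2 ⟨?_, hsF ?_⟩)
        · rintro rfl
          exact notMem_of_mem_faces ha hs hy
        · simp [hyx, hy]
    · obtain ⟨F, hF, hsF, hn⟩ := h.exists_facet s (Or.inl ⟨hs, hAs⟩)
      refine ⟨φ F, (hφ F hF hn).1, ?_, (hφ F hF hn).2⟩
      have : s ⊆ F.erase a := fun y hy => Finset.mem_erase.2
        ⟨fun e => notMem_of_mem_faces ha hs (e ▸ hy), hsF hy⟩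
      simp only [φ]
      split_ifs
      · exact this.trans Finset.subset_union_right
      · exact hsF
  · intro ρ hρ F hF G hG H hH hFn hGn hHn hρF hρG hρH
    have haρ : a ∉ ρ := fun h' => notMem_of_mem_faces ha hF (hρF h')
    by_cases hAρ : A ⊆ ρ
    · -- remove `x` and add `a`
      have key : ∀ E ∈ K.faces, E.card = n + 1 → ρ ⊆ E →
          insert a (E.erase x) ∈ (subdivide A a K).faces ∧ (insert a (E.erase x)).card = n + 1 ∧
          insert a (ρ.erase x) ⊆ insert a (E.erase x) := fun E hE hn hρE =>
        ⟨insert_erase_mem_subdivide ha hE (hAρ.trans hρE) hxA, by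
          rw [card_insert_erase_of_mem (notMem_of_mem_faces ha hE) (hρE (hAρ hxA)), hn],
          Finset.insert_subset_insert _ (Finset.erase_subset_erase _ hρE)⟩
      have inj : ∀ E ∈ K.faces, ∀ E' ∈ K.faces, ρ ⊆ E → ρ ⊆ E' →
          insert a (E.erase x) = insert a (E'.erase x) → E = E' := by
        intro E hE E' hE' hρE hρE' he
        have h1 := congrArg (fun s => insert x (s.erase a)) he
        rwa [Finset.erase_insert fun h => notMem_of_mem_faces ha hE (Finset.mem_of_mem_erase h),
          Finset.erase_insert fun h => notMem_of_mem_faces ha hE' (Finset.mem_of_mem_erase h),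
          Finset.insert_erase (hρE (hAρ hxA)), Finset.insert_erase (hρE' (hAρ hxA))] at h1
      obtain ⟨f1, f2, f3⟩ := key F hF hFn hρF
      obtain ⟨g1, g2, g3⟩ := key G hG hGn hρG
      obtain ⟨h1, h2, h3⟩ := key H hH hHn hρH
      rcases h.ridge (insert a (ρ.erase x))
        (by rw [card_insert_erase_of_mem haρ (hAρ hxA), hρ]) _ f1 _ g1 _ h1 f2 g2 h2 f3 g3 h3
        with e | e | e
      · exact Or.inl (inj _ hF _ hG hρF hρG e)
      · exact Or.inr (Or.inl (inj _ hF _ hH hρF hρH e))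
      · exact Or.inr (Or.inr (inj _ hG _ hH hρG hρH e))
    -- The only facet through `ρ` that can contain `A` is `A ∪ ρ`. It is traded for `insert a ρ`, so
    -- `ρ` itself serves as the ridge of the starring.
    · let ψ : Finset ℕ → Finset ℕ := fun E => if A ⊆ E then insert a ρ else E
      have eqU : ∀ E ∈ K.faces, E.card = n + 1 → ρ ⊆ E → A ⊆ E → E = A ∪ ρ := by
        intro E hE hn hρE hAE
        refine (Finset.eq_of_subset_of_card_le (Finset.union_subset hAE hρE) ?_).symm
        have := card_union_gt hAρ
        omega
      have key : ∀ E ∈ K.faces, E.card = n + 1 → ρ ⊆ E →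
          ψ E ∈ (subdivide A a K).faces ∧ (ψ E).card = n + 1 ∧ ρ ⊆ ψ E := by
        intro E hE hn hρE
        by_cases hAE : A ⊆ E
        · simp only [ψ, hAE, if_true]
          refine ⟨(insert_mem_subdivide ha haρ).2 ⟨hAρ, ?_⟩, ?_, Finset.subset_insert _ _⟩
          · rw [← eqU E hE hn hρE hAE]
            exact hE
          · rw [Finset.card_insert_of_notMem haρ, hρ]
        · simp only [ψ, hAE, if_false]
          exact ⟨Or.inl ⟨hE, hAE⟩, hn, hρE⟩
      have inj : ∀ E ∈ K.faces, ∀ E' ∈ K.faces, E.card = n + 1 → E'.card = n + 1 →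
          ρ ⊆ E → ρ ⊆ E' → ψ E = ψ E' → E = E' := by
        intro E hE E' hE' hn hn' hρE hρE' he
        simp only [ψ] at he
        split_ifs at he with h1 h2 h2
        · rw [eqU E hE hn hρE h1, eqU E' hE' hn' hρE' h2]
        · exact absurd (he ▸ Finset.mem_insert_self a ρ) (notMem_of_mem_faces ha hE')
        · exact absurd (he ▸ Finset.mem_insert_self a ρ) (notMem_of_mem_faces ha hE)
        · exact he
      obtain ⟨f1, f2, f3⟩ := key F hF hFn hρF
      obtain ⟨g1, g2, g3⟩ := key G hG hGn hρG
      obtain ⟨h1, h2, h3⟩ := key H hH hHn hρH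
      rcases h.ridge ρ hρ _ f1 _ g1 _ h1 f2 g2 h2 f3 g3 h3 with e | e | e
      · exact Or.inl (inj _ hF _ hG hFn hGn hρF hρG e)
      · exact Or.inr (Or.inl (inj _ hF _ hH hFn hHn hρF hρH e))
      · exact Or.inr (Or.inr (inj _ hG _ hH hGn hHn hρG hρH e))
  · have surj : ∀ F ∈ K.faces, F.card = n + 1 →
        ∃ F' ∈ (subdivide A a K).faces, F'.card = n + 1 ∧ φ F' = F := by
      intro F hF hn
      have haF := notMem_of_mem_faces ha hF
      by_cases hAF : A ⊆ F
      · refine ⟨_, insert_erase_mem_subdivide ha hF hAF hxA, ?_, ?_⟩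
        · rw [card_insert_erase_of_mem haF (hAF hxA), hn]
        · simp only [φ, Finset.mem_insert_self, if_true]
          rw [Finset.erase_insert fun h => haF (Finset.mem_of_mem_erase h)]
          ext y
          simp only [Finset.mem_union, Finset.mem_erase]
          constructor
          · rintro (h | h)
            exacts [hAF h, h.2]
          · intro hy
            by_cases hyx : y = x
            · exact Or.inl (hyx ▸ hxA)
            · exact Or.inr ⟨hyx, hy⟩
      · exact ⟨F, Or.inl ⟨hF, hAF⟩, hn, by simp only [φ, haF, if_false]⟩
    have adj : ∀ F G, Adj n (subdivide A a K) F G → Adj n K (φ F) (φ G) := by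
      rintro F G ⟨⟨hF, hFn⟩, ⟨hG, hGn⟩, hFG⟩
      refine ⟨hφ F hF hFn, hφ G hG hGn, hFG.trans ?_⟩
      by_cases haFG : a ∈ F ∩ G
      · obtain ⟨haF, haG⟩ := Finset.mem_inter.1 haFG
        obtain ⟨β, hβ, rfl⟩ := eq_insert_erase_of_mem haF
        obtain ⟨γ, hγ, rfl⟩ := eq_insert_erase_of_mem haG
        obtain ⟨h1, h2⟩ := (insert_mem_subdivide ha hβ).1 hF
        simp only [φ, haF, haG, if_true, Finset.erase_insert hβ, Finset.erase_insert hγ]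
        rw [← Finset.insert_inter_distrib, Finset.card_insert_of_notMem fun h =>
          hβ (Finset.mem_inter.1 h).1, ← Finset.union_inter_distrib_left]
        exact card_union_gt fun h => h1 (h.trans Finset.inter_subset_left)
      · refine Finset.card_le_card fun y hy => ?_
        have hya : y ≠ a := fun e => haFG (e ▸ hy)
        obtain ⟨hyF, hyG⟩ := Finset.mem_inter.1 hy
        have aux : ∀ E : Finset ℕ, y ∈ E → y ∈ φ E := by
          intro E hE
          simp only [φ]
          split_ifs
          · exact Finset.mem_union_right _ (Finset.mem_erase.2 ⟨hya, hE⟩)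
          · exact hE
        exact Finset.mem_inter.2 ⟨aux _ hyF, aux _ hyG⟩
    intro F hF G hG hFn hGn
    obtain ⟨F', hF', hFn', rfl⟩ := surj F hF hFn
    obtain ⟨G', hG', hGn', rfl⟩ := surj G hG hGn
    exact (h.connected F' hF' G' hG' hFn' hGn').lift φ adj

/-- Strong connectedness lifts because the facets over one facet of `K` are pairwise adjacent, and
adjacent facets of `K` have adjacent facets over them. -/
theorem IsPseudomanifold.subdivide (hA : A ∈ K.faces) (ha : a ∉ K.vertices)
    (h : IsPseudomanifold n K) : IsPseudomanifold n (subdivide A a K) := by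
  obtain ⟨x₀, hx₀⟩ := nonempty_of_mem hA
  refine ⟨⟨_, insert_erase_mem_subdivide ha hA subset_rfl hx₀⟩, ?_, ?_, ?_, ?_⟩
  · intro s hs
    by_cases has : a ∈ s
    · obtain ⟨β, hβ, rfl⟩ := eq_insert_erase_of_mem has
      obtain ⟨h1, h2⟩ := (insert_mem_subdivide ha hβ).1 hs
      rw [Finset.card_insert_of_notMem hβ]
      exact (card_union_gt h1).trans (h.card_le _ h2)
    · exact h.card_le _ ((mem_subdivide_of_notMem has).1 hs).1
  · have key : ∀ β : Finset ℕ, a ∉ β → ¬ A ⊆ β → ∀ F ∈ K.faces, F.card = n + 1 → A ⊆ F → β ⊆ F →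
        ∃ F' ∈ (Cplx.subdivide A a K).faces, insert a β ⊆ F' ∧ F'.card = n + 1 := by
      intro β hβ hAβ F hF hn hAF hβF
      obtain ⟨x, hx, hxβ⟩ := Finset.not_subset.1 hAβ
      refine ⟨_, insert_erase_mem_subdivide ha hF hAF hx, Finset.insert_subset_insert _ ?_, ?_⟩
      · exact fun y hy => Finset.mem_erase.2 ⟨fun e => hxβ (e ▸ hy), hβF hy⟩
      · rw [card_insert_erase_of_mem (notMem_of_mem_faces ha hF) (hAF hx), hn]
    intro s hs
    by_cases has : a ∈ s
    · obtain ⟨β, hβ, rfl⟩ := eq_insert_erase_of_mem has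
      obtain ⟨h1, h2⟩ := (insert_mem_subdivide ha hβ).1 hs
      obtain ⟨F, hF, hsF, hn⟩ := h.exists_facet _ h2
      exact key β hβ h1 F hF hn (Finset.subset_union_left.trans hsF)
        (Finset.subset_union_right.trans hsF)
    · obtain ⟨h1, h2⟩ := (mem_subdivide_of_notMem has).1 hs
      obtain ⟨F, hF, hsF, hn⟩ := h.exists_facet _ h1
      by_cases hAF : A ⊆ F
      · obtain ⟨F', hF', hs', hn'⟩ := key s has h2 F hF hn hAF hsF
        exact ⟨F', hF', (Finset.subset_insert _ _).trans hs', hn'⟩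
      · exact ⟨F, Or.inl ⟨hF, hAF⟩, hsF, hn⟩
  · intro ρ hρ F hF G hG H hH hFn hGn hHn hρF hρG hρH
    by_cases haρ : a ∈ ρ
    · obtain ⟨β, hβ, rfl⟩ := eq_insert_erase_of_mem haρ
      rw [Finset.card_insert_of_notMem hβ] at hρ
      -- a facet over the ridge is obtained by adding one vertex
      have key : ∀ E ∈ (Cplx.subdivide A a K).faces, E.card = n + 1 → insert a β ⊆ E →
          ∃ z, E = insert a (insert z β) ∧ z ∉ β ∧ ¬ A ⊆ insert z β ∧
            A ∪ insert z β ∈ K.faces ∧ (A ∪ insert z β).card = n + 1 := by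
        intro E hE hn hβE
        obtain ⟨γ, hγ, rfl⟩ := eq_insert_erase_of_mem (hβE (Finset.mem_insert_self _ _))
        obtain ⟨h1, h2⟩ := (insert_mem_subdivide ha hγ).1 hE
        rw [Finset.card_insert_of_notMem hγ] at hn
        have hβγ : β ⊆ γ := by
          intro y hy
          exact Finset.mem_of_mem_insert_of_ne (hβE (Finset.mem_insert_of_mem hy))
            fun e => hβ (e ▸ hy)
        obtain ⟨z, hz, rfl⟩ : ∃ z, z ∉ β ∧ insert z β = γ :=
          Finset.covBy_iff_exists_insert.1 (Finset.covBy_iff_card_sdiff_eq_one.2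
            ⟨hβγ, by rw [Finset.card_sdiff_of_subset hβγ]; omega⟩)
        have := card_union_gt h1
        have := h.card_le _ h2
        exact ⟨z, rfl, hz, h1, h2, by omega⟩
      obtain ⟨z₁, rfl, hz₁, f1, f2, f3⟩ := key F hF hFn hρF
      obtain ⟨z₂, rfl, hz₂, g1, g2, g3⟩ := key G hG hGn hρG
      obtain ⟨z₃, rfl, hz₃, h1, h2, h3⟩ := key H hH hHn hρH
      by_cases hAβ : (A ∪ β).card = n
      · -- the vertices `zᵢ` span facets with the ridge `A ∪ β`
        have aux : ∀ z, A ∪ insert z β = insert z (A ∪ β) := fun z => Finset.union_insert z A β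
        have inj : ∀ z z', (A ∪ insert z β).card = n + 1 → (A ∪ insert z' β).card = n + 1 →
            A ∪ insert z β = A ∪ insert z' β → z = z' := by
          intro z z' hz hz' he
          rw [aux, aux] at he
          rw [aux] at hz
          have hzn : z ∉ A ∪ β := fun hm => by
            rw [Finset.insert_eq_of_mem hm] at hz
            omega
          have : z ∈ insert z' (A ∪ β) := he ▸ Finset.mem_insert_self _ _
          exact (Finset.mem_insert.1 this).resolve_right hzn
        have sub : ∀ z, A ∪ β ⊆ A ∪ insert z β := fun z =>
          Finset.union_subset_union_right (Finset.subset_insert _ _)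
        rcases h.ridge _ hAβ _ f2 _ g2 _ h2 f3 g3 h3 (sub _) (sub _) (sub _) with e | e | e
        · exact Or.inl (by rw [inj _ _ f3 g3 e])
        · exact Or.inr (Or.inl (by rw [inj _ _ f3 h3 e]))
        · exact Or.inr (Or.inr (by rw [inj _ _ g3 h3 e]))
      · -- the vertices `zᵢ` lie in the two-element set `A \ β`
        have hmem : ∀ z, z ∉ β → (A ∪ insert z β).card = n + 1 → ¬ A ⊆ insert z β →
            z ∈ A \ β ∧ (A \ β).card = 2 := by
          intro z hz hn hA'
          have e : A ∪ insert z β = insert z (A ∪ β) := Finset.union_insert z A β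
          rw [e] at hn
          have hle : β.card + 1 ≤ (A ∪ β).card :=
            card_union_gt fun h' => hA' (h'.trans (Finset.subset_insert _ _))
          have hzm : z ∈ A ∪ β := by
            by_contra hzn
            rw [Finset.card_insert_of_notMem hzn] at hn
            omega
          have hzA := (Finset.mem_union.1 hzm).resolve_right hz
          rw [Finset.insert_eq_of_mem hzm] at hn
          refine ⟨Finset.mem_sdiff.2 ⟨hzA, hz⟩, ?_⟩
          have := Finset.card_sdiff_add_card A β
          omega
        obtain ⟨m1, m⟩ := hmem z₁ hz₁ f3 f1
        obtain ⟨m2, -⟩ := hmem z₂ hz₂ g3 g1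
        obtain ⟨m3, -⟩ := hmem z₃ hz₃ h3 h1
        obtain ⟨u, v, -, huv⟩ := Finset.card_eq_two.1 m
        rw [huv] at m1 m2 m3
        simp only [Finset.mem_insert, Finset.mem_singleton] at m1 m2 m3
        rcases m1 with rfl | rfl <;> rcases m2 with rfl | rfl <;> rcases m3 with rfl | rfl <;> simp
    -- The only facet through both `a` and `ρ` is `insert a ρ`, and it comes from the facet `A ∪ ρ`
    -- of `K`; facets without `a` do not contain `A`, so `φ` is injective on the facets over `ρ`.
    · let φ : Finset ℕ → Finset ℕ := fun F => if a ∈ F then A ∪ ρ else F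
      have key : ∀ E ∈ (Cplx.subdivide A a K).faces, E.card = n + 1 → ρ ⊆ E →
          φ E ∈ K.faces ∧ (φ E).card = n + 1 ∧ ρ ⊆ φ E ∧ (a ∈ E → E = insert a ρ) ∧
            (a ∉ E → ¬ A ⊆ E) := by
        intro E hE hn hρE
        by_cases haE : a ∈ E
        · have hE' : insert a ρ = E := Finset.eq_of_subset_of_card_le
            (Finset.insert_subset haE hρE) (by rw [Finset.card_insert_of_notMem haρ]; omega)
          obtain ⟨h1, h2⟩ := (insert_mem_subdivide ha haρ).1 (hE' ▸ hE)
          have := card_union_gt h1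
          have := h.card_le _ h2
          simp only [φ, haE, if_true]
          exact ⟨h2, by omega, Finset.subset_union_right, fun _ => hE'.symm, fun h => absurd trivial h⟩
        · obtain ⟨h1, h2⟩ := (mem_subdivide_of_notMem haE).1 hE
          simp only [φ, haE, if_false]
          exact ⟨h1, hn, hρE, fun h => h.elim, fun _ => h2⟩
      have inj : ∀ E ∈ (Cplx.subdivide A a K).faces, ∀ E' ∈ (Cplx.subdivide A a K).faces,
          E.card = n + 1 → E'.card = n + 1 → ρ ⊆ E → ρ ⊆ E' → φ E = φ E' → E = E' := by
        intro E hE E' hE' hn hn' hρE hρE' he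
        obtain ⟨-, -, -, e1, e2⟩ := key E hE hn hρE
        obtain ⟨-, -, -, e1', e2'⟩ := key E' hE' hn' hρE'
        simp only [φ] at he
        split_ifs at he with h1 h2 h2
        · rw [e1 h1, e1' h2]
        · exact absurd (he ▸ Finset.subset_union_left) (e2' h2)
        · exact absurd (he ▸ Finset.subset_union_left) (e2 h1)
        · exact he
      obtain ⟨f1, f2, f3, -⟩ := key F hF hFn hρF
      obtain ⟨g1, g2, g3, -⟩ := key G hG hGn hρG
      obtain ⟨h1, h2, h3, -⟩ := key H hH hHn hρH
      rcases h.ridge ρ hρ _ f1 _ g1 _ h1 f2 g2 h2 f3 g3 h3 with e | e | e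
      · exact Or.inl (inj _ hF _ hG hFn hGn hρF hρG e)
      · exact Or.inr (Or.inl (inj _ hF _ hH hFn hHn hρF hρH e))
      · exact Or.inr (Or.inr (inj _ hG _ hH hGn hHn hρG hρH e))
  · -- facets of the starring over a facet of the complex
    let Over : Finset ℕ → Finset ℕ → Prop := fun F E =>
      E ∈ (Cplx.subdivide A a K).faces ∧ E.card = n + 1 ∧
        ((¬ A ⊆ F ∧ E = F) ∨ (A ⊆ F ∧ ∃ x ∈ A, E = insert a (F.erase x)))
    have fiber : ∀ F ∈ K.faces, F.card = n + 1 → ∀ E E', Over F E → Over F E' →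
        Relation.ReflTransGen (Adj n (Cplx.subdivide A a K)) E E' := by
      rintro F hF hn E E' ⟨hE, hEn, ⟨h1, rfl⟩ | ⟨h1, x, hx, rfl⟩⟩
        ⟨hE', hEn', ⟨h1', rfl⟩ | ⟨h1', y, hy, rfl⟩⟩
      · exact Relation.ReflTransGen.refl
      · exact absurd h1' h1
      · exact absurd h1 h1'
      · refine Relation.ReflTransGen.single ⟨⟨hE, hEn⟩, ⟨hE', hEn'⟩, ?_⟩
        have haF := notMem_of_mem_faces ha hF
        have hs : insert a ((F.erase x).erase y) ⊆
            insert a (F.erase x) ∩ insert a (F.erase y) := by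
          intro z hz
          simp only [Finset.mem_insert, Finset.mem_erase, Finset.mem_inter] at hz ⊢
          tauto
        refine le_trans ?_ (Finset.card_le_card hs)
        rw [Finset.card_insert_of_notMem (by simp [haF])]
        have h2 := Finset.pred_card_le_card_erase (s := F.erase x) (a := y)
        have h3 := Finset.pred_card_le_card_erase (s := F) (a := x)
        omega
    have step : ∀ F G, Adj n K F G → ∃ E E', Over F E ∧ Over G E' ∧
        Adj n (Cplx.subdivide A a K) E E' := by
      rintro F G ⟨⟨hF, hFn⟩, ⟨hG, hGn⟩, hFG⟩
      obtain ⟨ρ, hρFG, hρ⟩ := Finset.exists_subset_card_eq hFG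
      have hρF := hρFG.trans Finset.inter_subset_left
      have hρG := hρFG.trans Finset.inter_subset_right
      have haρ : a ∉ ρ := fun h' => notMem_of_mem_faces ha hF (hρF h')
      -- One ridge `ρ'` of the starring that meets the fibre over every facet through `ρ` makes the
      -- two fibres adjacent. If `A ⊆ ρ`, a vertex of `A` is exchanged for `a`; otherwise `ρ`
      -- survives.
      suffices ∃ ρ' : Finset ℕ, ρ'.card = n ∧ ∀ E ∈ K.faces, E.card = n + 1 → ρ ⊆ E →
          ∃ E', Over E E' ∧ ρ' ⊆ E' by
        obtain ⟨ρ', hn, hρ'⟩ := this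
        obtain ⟨E, hE, hE'⟩ := hρ' F hF hFn hρF
        obtain ⟨E₂, hE₂, hE₂'⟩ := hρ' G hG hGn hρG
        exact ⟨E, E₂, hE, hE₂, ⟨hE.1, hE.2.1⟩, ⟨hE₂.1, hE₂.2.1⟩,
          hn ▸ Finset.card_le_card (Finset.subset_inter hE' hE₂')⟩
      by_cases hAρ : A ⊆ ρ
      · refine ⟨insert a (ρ.erase x₀), by rw [card_insert_erase_of_mem haρ (hAρ hx₀), hρ], ?_⟩
        intro E hE hn hρE
        refine ⟨insert a (E.erase x₀), ⟨insert_erase_mem_subdivide ha hE (hAρ.trans hρE) hx₀, ?_,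
          Or.inr ⟨hAρ.trans hρE, x₀, hx₀, rfl⟩⟩,
          Finset.insert_subset_insert _ (Finset.erase_subset_erase _ hρE)⟩
        rw [card_insert_erase_of_mem (notMem_of_mem_faces ha hE) (hρE (hAρ hx₀)), hn]
      · obtain ⟨x, hx, hxρ⟩ := Finset.not_subset.1 hAρ
        refine ⟨ρ, hρ, fun E hE hn hρE => ?_⟩
        by_cases hAE : A ⊆ E
        · refine ⟨insert a (E.erase x), ⟨insert_erase_mem_subdivide ha hE hAE hx, ?_,
            Or.inr ⟨hAE, x, hx, rfl⟩⟩, fun y hy => Finset.mem_insert_of_mem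
              (Finset.mem_erase.2 ⟨fun e => hxρ (e ▸ hy), hρE hy⟩)⟩
          rw [card_insert_erase_of_mem (notMem_of_mem_faces ha hE) (hAE hx), hn]
        · exact ⟨E, ⟨Or.inl ⟨hE, hAE⟩, hn, Or.inl ⟨hAE, rfl⟩⟩, hρE⟩
    have path : ∀ F G, F ∈ K.faces → F.card = n + 1 → Relation.ReflTransGen (Adj n K) F G →
        ∀ E E', Over F E → Over G E' →
          Relation.ReflTransGen (Adj n (Cplx.subdivide A a K)) E E' := by
      intro F G hF hn hFG
      induction hFG with
      | refl => exact fiber F hF hn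
      | tail hFG hGH ih =>
        intro E E' hE hE'
        obtain ⟨E₁, E₂, h1, h2, h12⟩ := step _ _ hGH
        exact ((ih E E₁ hE h1).tail h12).trans (fiber _ hGH.2.1.1 hGH.2.1.2 _ _ h2 hE')
    have cover : ∀ E ∈ (Cplx.subdivide A a K).faces, E.card = n + 1 →
        ∃ F ∈ K.faces, F.card = n + 1 ∧ Over F E := by
      intro E hE hn
      rcases facet_subdivide h.card_le ha hE hn with ⟨h1, h2, h3⟩ | ⟨F, hF, hFn, hAF, x, hx, rfl⟩
      · exact ⟨E, h2, hn, hE, hn, Or.inl ⟨h3, rfl⟩⟩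
      · exact ⟨F, hF, hFn, hE, hn, Or.inr ⟨hAF, x, hx, rfl⟩⟩
    intro E hE E' hE' hn hn'
    obtain ⟨F, hF, hFn, hFE⟩ := cover E hE hn
    obtain ⟨G, hG, hGn, hGE⟩ := cover E' hE' hn'
    exact path F G hF hFn (h.connected F hF G hG hFn hGn) E E' hFE hGE

end Subdivide

theorem IsPseudomanifold.of_map {n : ℕ} {K : Cplx} {f : ℕ → ℕ} (hf : Set.InjOn f K.vertices)
    (h : IsPseudomanifold n (K.map f)) : IsPseudomanifold n K := by
  have sub : ∀ s ∈ K.faces, (s : Set ℕ) ⊆ K.vertices := fun s hs v hv => mem_vertices_of_mem hs hv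
  have im : ∀ s ∈ K.faces, s.image f ∈ (K.map f).faces := fun s hs => ⟨s, hs, rfl⟩
  have card : ∀ s ∈ K.faces, (s.image f).card = s.card := fun s hs =>
    Finset.card_image_of_injOn (hf.mono (sub s hs))
  have le : ∀ s ∈ K.faces, ∀ t ∈ K.faces, s.image f ⊆ t.image f → s ⊆ t := by
    intro s hs t ht hst v hv
    obtain ⟨w, hw, he⟩ := Finset.mem_image.1 (hst (Finset.mem_image_of_mem f hv))
    exact hf (sub t ht hw) (sub s hs hv) he ▸ hw
  have inj : ∀ s ∈ K.faces, ∀ t ∈ K.faces, s.image f = t.image f → s = t := fun s hs t ht e =>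
    (le s hs t ht e.subset).antisymm (le t ht s hs e.symm.subset)
  refine ⟨?_, ?_, ?_, ?_, ?_⟩
  · obtain ⟨_, s, hs, -⟩ := h.nonempty
    exact ⟨s, hs⟩
  · exact fun s hs => card s hs ▸ h.card_le _ (im s hs)
  · intro s hs
    obtain ⟨_, ⟨F, hF, rfl⟩, hsF, hn⟩ := h.exists_facet _ (im s hs)
    exact ⟨F, hF, le s hs F hF hsF, card F hF ▸ hn⟩
  · intro ρ hρ F hF G hG H hH hFn hGn hHn hρF hρG hρH
    rcases h.ridge (ρ.image f) (by rw [Finset.card_image_of_injOn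
        (hf.mono ((Finset.coe_subset.2 hρF).trans (sub F hF))), hρ]) _ (im F hF) _ (im G hG) _
        (im H hH) (card F hF ▸ hFn) (card G hG ▸ hGn) (card H hH ▸ hHn)
        (Finset.image_subset_image hρF) (Finset.image_subset_image hρG)
        (Finset.image_subset_image hρH) with e | e | e
    · exact Or.inl (inj _ hF _ hG e)
    · exact Or.inr (Or.inl (inj _ hF _ hH e))
    · exact Or.inr (Or.inr (inj _ hG _ hH e))
  · intro F hF G hG hFn hGn
    have key : ∀ F' G', Relation.ReflTransGen (Adj n (K.map f)) F' G' → ∀ F ∈ K.faces,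
        F.card = n + 1 → F.image f = F' → ∀ G ∈ K.faces, G.image f = G' →
        Relation.ReflTransGen (Adj n K) F G := by
      intro F' G' hFG
      induction hFG with
      | refl =>
        intro F hF hn he G hG he'
        rw [inj F hF G hG (he.trans he'.symm)]
      | tail h1 h2 ih =>
        intro F hF hn he G hG he'
        obtain ⟨⟨⟨E, hE, rfl⟩, hEn⟩, ⟨-, hGn⟩, hEG⟩ := h2
        subst he'
        refine (ih F hF hn he E hE rfl).tail ⟨⟨hE, card E hE ▸ hEn⟩, ⟨hG, card G hG ▸ hGn⟩,
          hEG.trans ?_⟩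
        have hs : E.image f ∩ G.image f ⊆ (E ∩ G).image f := by
          intro y hy
          obtain ⟨h3, h4⟩ := Finset.mem_inter.1 hy
          obtain ⟨u, hu, rfl⟩ := Finset.mem_image.1 h3
          obtain ⟨v, hv, he⟩ := Finset.mem_image.1 h4
          have := hf (sub G hG hv) (sub E hE hu) he
          exact Finset.mem_image_of_mem f (Finset.mem_inter.2 ⟨hu, this ▸ hv⟩)
        exact (Finset.card_le_card hs).trans Finset.card_image_le
    exact key _ _ (h.connected _ (im F hF) _ (im G hG) (card F hF ▸ hFn) (card G hG ▸ hGn))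
      F hF hFn rfl G hG rfl

/-- The property is carried backwards along the moves, so a subdivision calls for `of_subdivide` and
a weld for `subdivide`. -/
theorem IsPseudomanifold.of_stellarEquiv {n : ℕ} {K L : Cplx} (h : StellarEquiv K L)
    (hL : IsPseudomanifold n L) : IsPseudomanifold n K := by
  have h' : Relation.ReflTransGen StellarMove K L := h
  induction h' using Relation.ReflTransGen.head_induction_on with
  | refl => exact hL
  | head hm ht ih =>
    cases hm with
    | subdivision _ A a hA ha => exact (ih ht).of_subdivide hA ha
    | weld _ A a hA ha => exact (ih ht).subdivide hA ha
    | renumber _ f hf => exact (ih ht).of_map hf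

theorem isPseudomanifold_simplex (n : ℕ) : IsPseudomanifold n (simplex n) := by
  have eq : ∀ F ∈ (simplex n).faces, F.card = n + 1 → F = Finset.range (n + 1) := fun F hF hn =>
    Finset.eq_of_subset_of_card_le hF.2 (by rw [Finset.card_range, hn])
  refine ⟨⟨Finset.range (n + 1), by simp, subset_rfl⟩, ?_, ?_, ?_, ?_⟩
  · exact fun s hs => (Finset.card_le_card hs.2).trans (Finset.card_range _).le
  · exact fun s hs => ⟨Finset.range (n + 1), ⟨by simp, subset_rfl⟩, hs.2, Finset.card_range _⟩
  · intro ρ _ F hF G hG _ _ hFn hGn _ _ _ _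
    exact Or.inl (by rw [eq F hF hFn, eq G hG hGn])
  · intro F hF G hG hFn hGn
    rw [eq F hF hFn, eq G hG hGn]

/-- A facet omits one vertex and a ridge omits two, so a ridge lies in at most two facets and any
two facets are adjacent. -/
theorem isPseudomanifold_simplexBoundary (n : ℕ) : IsPseudomanifold n (simplexBoundary n) := by
  have lt : ∀ s ∈ (simplexBoundary n).faces, s.card < n + 2 := fun s hs => by
    simpa using Finset.card_lt_card hs.2
  have facet : ∀ x < n + 2, (Finset.range (n + 2)).erase x ∈ (simplexBoundary n).faces ∧
      ((Finset.range (n + 2)).erase x).card = n + 1 := by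
    intro x hx
    have hc : ((Finset.range (n + 2)).erase x).card = n + 1 := by
      rw [Finset.card_erase_of_mem (Finset.mem_range.2 hx), Finset.card_range]
      rfl
    exact ⟨⟨Finset.card_pos.1 (by omega), Finset.erase_ssubset (Finset.mem_range.2 hx)⟩, hc⟩
  have eq : ∀ F ∈ (simplexBoundary n).faces, F.card = n + 1 →
      ∃ x, x < n + 2 ∧ x ∉ F ∧ F = (Finset.range (n + 2)).erase x := by
    intro F hF hn
    obtain ⟨x, hx, hxF⟩ := Finset.exists_of_ssubset hF.2
    refine ⟨x, Finset.mem_range.1 hx, hxF, Finset.eq_of_subset_of_card_le ?_ ?_⟩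
    · exact fun y hy => Finset.mem_erase.2 ⟨fun e => hxF (e ▸ hy), hF.2.subset hy⟩
    · rw [(facet x (Finset.mem_range.1 hx)).2, hn]
  refine ⟨⟨_, (facet 0 (by omega)).1⟩, fun s hs => Nat.lt_succ_iff.1 (lt s hs), ?_, ?_, ?_⟩
  · intro s hs
    obtain ⟨x, hx, hxs⟩ := Finset.exists_of_ssubset hs.2
    refine ⟨_, (facet x (Finset.mem_range.1 hx)).1, ?_, (facet x (Finset.mem_range.1 hx)).2⟩
    exact fun y hy => Finset.mem_erase.2 ⟨fun e => hxs (e ▸ hy), hs.2.subset hy⟩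
  · intro ρ hρ F hF G hG H hH hFn hGn hHn hρF hρG hρH
    have hsub : ρ ⊆ Finset.range (n + 2) := hρF.trans hF.2.subset
    have hc : (Finset.range (n + 2) \ ρ).card = 2 := by
      rw [Finset.card_sdiff_of_subset hsub, Finset.card_range]
      omega
    obtain ⟨u, v, -, huv⟩ := Finset.card_eq_two.1 hc
    have key : ∀ E ∈ (simplexBoundary n).faces, E.card = n + 1 → ρ ⊆ E →
        E = (Finset.range (n + 2)).erase u ∨ E = (Finset.range (n + 2)).erase v := by
      intro E hE hn hρE
      obtain ⟨x, hx, hxE, he⟩ := eq E hE hn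
      have : x ∈ Finset.range (n + 2) \ ρ :=
        Finset.mem_sdiff.2 ⟨Finset.mem_range.2 hx, fun h => hxE (hρE h)⟩
      rw [huv, Finset.mem_insert, Finset.mem_singleton] at this
      rcases this with rfl | rfl
      exacts [Or.inl he, Or.inr he]
    rcases key F hF hFn hρF with rfl | rfl <;> rcases key G hG hGn hρG with rfl | rfl <;>
      rcases key H hH hHn hρH with rfl | rfl <;> simp
  · intro F hF G hG hFn hGn
    refine Relation.ReflTransGen.single ⟨⟨hF, hFn⟩, ⟨hG, hGn⟩, ?_⟩
    have := Finset.card_union_add_card_inter F G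
    have := Finset.card_le_card (Finset.union_subset hF.2.subset hG.2.subset)
    rw [Finset.card_range] at this
    omega

/-! ### From vertex links to the complex; generators and closedness. -/

theorem insert_mem_of_link {M : Cplx} {v : ℕ} {s : Finset ℕ} (hs : s ∈ (link {v} M).faces) :
    v ∉ s ∧ insert v s ∈ M.faces :=
  ⟨Finset.disjoint_singleton_left.1 hs.2.1, by
    have := hs.2.2
    rwa [← Finset.insert_eq] at this⟩

theorem mem_link {M : Cplx} {v : ℕ} {s : Finset ℕ} (hs : s.Nonempty) (hv : v ∉ s)
    (h : insert v s ∈ M.faces) : s ∈ (link {v} M).faces :=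
  ⟨hs, Finset.disjoint_singleton_left.2 hv, by rwa [← Finset.insert_eq]⟩

theorem erase_mem_link {M : Cplx} {v : ℕ} {s : Finset ℕ} (hs : s ∈ M.faces) (hv : v ∈ s)
    (h : (s.erase v).Nonempty) : s.erase v ∈ (link {v} M).faces :=
  mem_link h (Finset.notMem_erase v s) (by rwa [Finset.insert_erase hv])

/-- A connected complex is a pseudomanifold if all its vertex links are. -/
theorem IsPseudomanifold.of_link {n : ℕ} (hn : 0 < n) {M : Cplx} (hM : M.Connected)
    (h : ∀ v ∈ M.vertices, IsPseudomanifold n (link {v} M)) : IsPseudomanifold (n + 1) M := by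
  have exists_facet : ∀ s ∈ M.faces, ∃ F ∈ M.faces, s ⊆ F ∧ F.card = n + 1 + 1 := by
    intro s hs
    obtain ⟨v, hv⟩ := nonempty_of_mem hs
    have hl := h v (mem_vertices_of_mem hs hv)
    suffices ∃ F ∈ (link {v} M).faces, s.erase v ⊆ F ∧ F.card = n + 1 by
      obtain ⟨F, hF, hsF, hn⟩ := this
      obtain ⟨h1, h2⟩ := insert_mem_of_link hF
      refine ⟨_, h2, ?_, by rw [Finset.card_insert_of_notMem h1, hn]⟩
      rw [← Finset.insert_erase hv]
      exact Finset.insert_subset_insert _ hsF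
    rcases (s.erase v).eq_empty_or_nonempty with h0 | h0
    · obtain ⟨s', hs'⟩ := hl.nonempty
      obtain ⟨F, hF, -, hn⟩ := hl.exists_facet s' hs'
      exact ⟨F, hF, by simp [h0], hn⟩
    · exact hl.exists_facet _ (erase_mem_link hs hv h0)
  -- A chain of facets in the link of `v` becomes a chain in `M` after joining with `v`.
  have star : ∀ v, ∀ F ∈ M.faces, ∀ G ∈ M.faces, F.card = n + 1 + 1 → G.card = n + 1 + 1 →
      v ∈ F → v ∈ G → Relation.ReflTransGen (Adj (n + 1) M) F G := by
    intro v F hF G hG hFn hGn hvF hvG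
    have c : ∀ E : Finset ℕ, E.card = n + 1 + 1 → v ∈ E → (E.erase v).card = n + 1 :=
      fun E hn hv => by rw [Finset.card_erase_of_mem hv, hn]; rfl
    have ne : ∀ E : Finset ℕ, E.card = n + 1 + 1 → v ∈ E → (E.erase v).Nonempty :=
      fun E hn hv => Finset.card_pos.1 (by rw [c E hn hv]; omega)
    have := (h v (mem_vertices_of_mem hF hvF)).connected _
      (erase_mem_link hF hvF (ne F hFn hvF)) _
      (erase_mem_link hG hvG (ne G hGn hvG)) (c F hFn hvF) (c G hGn hvG)
    rw [← Finset.insert_erase hvF, ← Finset.insert_erase hvG]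
    refine this.lift (insert v) ?_
    rintro A B ⟨⟨hA, hAn⟩, ⟨hB, hBn⟩, hAB⟩
    obtain ⟨hvA, hA'⟩ := insert_mem_of_link hA
    obtain ⟨hvB, hB'⟩ := insert_mem_of_link hB
    refine ⟨⟨hA', by rw [Finset.card_insert_of_notMem hvA, hAn]⟩,
      ⟨hB', by rw [Finset.card_insert_of_notMem hvB, hBn]⟩, ?_⟩
    rw [← Finset.insert_inter_distrib, Finset.card_insert_of_notMem fun h =>
      hvA (Finset.mem_inter.1 h).1]
    omega
  refine ⟨?_, ?_, exists_facet, ?_, ?_⟩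
  · obtain ⟨v, hv⟩ := hM.1
    exact ⟨_, hv⟩
  · intro s hs
    obtain ⟨v, hv⟩ := nonempty_of_mem hs
    rcases (s.erase v).eq_empty_or_nonempty with h0 | h0
    · have := Finset.card_erase_add_one hv
      rw [h0, Finset.card_empty] at this
      omega
    · have := (h v (mem_vertices_of_mem hs hv)).card_le _ (erase_mem_link hs hv h0)
      have := Finset.card_erase_add_one hv
      omega
  · intro ρ hρ F hF G hG H hH hFn hGn hHn hρF hρG hρH
    obtain ⟨v, hv⟩ : ρ.Nonempty := Finset.card_pos.1 (by omega)
    have c : ∀ E : Finset ℕ, E.card = n + 1 + 1 → v ∈ E → (E.erase v).card = n + 1 :=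
      fun E hn hv => by rw [Finset.card_erase_of_mem hv, hn]; rfl
    have ne : ∀ E : Finset ℕ, E.card = n + 1 + 1 → v ∈ E → (E.erase v).Nonempty :=
      fun E hn hv => Finset.card_pos.1 (by rw [c E hn hv]; omega)
    have inj : ∀ E E' : Finset ℕ, v ∈ E → v ∈ E' → E.erase v = E'.erase v → E = E' := by
      intro E E' h1 h2 he
      rw [← Finset.insert_erase h1, he, Finset.insert_erase h2]
    have m := fun E hE (hn : E.card = n + 1 + 1) hv =>
      erase_mem_link (M := M) (v := v) (s := E) hE hv (ne E hn hv)
    rcases (h v (mem_vertices_of_mem hF (hρF hv))).ridge (ρ.erase v)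
      (by rw [Finset.card_erase_of_mem hv, hρ]; rfl) _ (m F hF hFn (hρF hv)) _
      (m G hG hGn (hρG hv)) _ (m H hH hHn (hρH hv)) (c F hFn (hρF hv)) (c G hGn (hρG hv))
      (c H hHn (hρH hv)) (Finset.erase_subset_erase _ hρF) (Finset.erase_subset_erase _ hρG)
      (Finset.erase_subset_erase _ hρH) with e | e | e
    · exact Or.inl (inj _ _ (hρF hv) (hρG hv) e)
    · exact Or.inr (Or.inl (inj _ _ (hρF hv) (hρH hv) e))
    · exact Or.inr (Or.inr (inj _ _ (hρG hv) (hρH hv) e))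
  · intro F hF G hG hFn hGn
    obtain ⟨u, hu⟩ := nonempty_of_mem hF
    obtain ⟨v, hv⟩ := nonempty_of_mem hG
    have path := hM.2 u (mem_vertices_of_mem hF hu) v (mem_vertices_of_mem hG hv)
    -- Along an edge path, a facet containing an edge lies in the stars of both of its ends and
    -- links the chains in the two stars.
    have key : ∀ w, Relation.ReflTransGen (fun x y => ({x, y} : Finset ℕ) ∈ M.faces) u w →
        ∀ G ∈ M.faces, G.card = n + 1 + 1 → w ∈ G →
          Relation.ReflTransGen (Adj (n + 1) M) F G := by
      intro w hw
      induction hw with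
      | refl => exact fun G hG hGn hu' => star u F hF G hG hFn hGn hu hu'
      | tail _ h2 ih =>
        intro G hG hGn hw
        obtain ⟨E, hE, hs, hEn⟩ := exists_facet _ h2
        exact (ih E hE hEn (hs (by simp))).trans (star _ E hE G hG hEn hGn (hs (by simp)) hw)
    exact key v path G hG hGn hv

theorem IsStellarThreeManifold.isPseudomanifold {M : Cplx} (h : M.IsStellarThreeManifold)
    (hM : M.Connected) : IsPseudomanifold 3 M := by
  refine IsPseudomanifold.of_link (by omega) hM fun v hv => ?_
  rcases h v hv with h | h
  · exact (isPseudomanifold_simplex 2).of_stellarEquiv h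
  · exact (isPseudomanifold_simplexBoundary 2).of_stellarEquiv h

theorem IsPseudomanifold.mem_generators {n : ℕ} {K : Cplx} (h : IsPseudomanifold n K)
    {g : Finset ℕ} : g ∈ K.generators ↔ g ∈ K.faces ∧ g.card = n + 1 := by
  constructor
  · intro hg
    obtain ⟨F, hF, hgF, hn⟩ := h.exists_facet g hg.1
    rw [subset_antisymm hgF (hg.2 hF hgF)]
    exact ⟨hF, hn⟩
  · rintro ⟨hg, hn⟩
    refine ⟨hg, fun s hs hgs => ?_⟩
    exact (Finset.eq_of_subset_of_card_le hgs (by rw [hn]; exact h.card_le s hs)).symm.subset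

theorem IsPseudomanifold.finite {n : ℕ} {K : Cplx} (h : IsPseudomanifold n K)
    (hK : K.generators.Finite) : K.faces.Finite := by
  refine (hK.biUnion fun g _ => (Finset.finite_toSet g.powerset)).subset fun s hs => ?_
  obtain ⟨F, hF, hsF, hn⟩ := h.exists_facet s hs
  exact Set.mem_biUnion (h.mem_generators.2 ⟨hF, hn⟩) (Finset.mem_coe.2 (Finset.mem_powerset.2 hsF))

/-- In a closed complex a simplex of codimension one lies in a second facet. -/
theorem IsPseudomanifold.exists_ne_of_closed {n : ℕ} {K : Cplx} (h : IsPseudomanifold n K)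
    (hK : K.generators.Finite) (hc : K.Closed) {t T : Finset ℕ} (ht : t.card = n)
    (hT : T ∈ K.faces) (hn : T.card = n + 1) (htT : t ⊆ T) :
    ∃ T' ∈ K.faces, T'.card = n + 1 ∧ t ⊆ T' ∧ T' ≠ T := by
  by_contra! hno
  obtain ⟨x, hx, rfl⟩ : ∃ x ∉ t, insert x t = T :=
    Finset.covBy_iff_exists_insert.1 (Finset.covBy_iff_card_sdiff_eq_one.2
      ⟨htT, by rw [Finset.card_sdiff_of_subset htT]; omega⟩)
  have hb : (∑ g ∈ hK.toFinset, ∑ i ∈ g, Finsupp.single (g.erase i) (1 : ZMod 2)) = 0 := by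
    rw [← finsum_mem_eq_finite_toFinset_sum _ hK]
    exact hc
  -- The coefficient of `t` in the boundary counts the facets through `t` modulo 2. Under `hno` only
  -- `T` contributes, through its vertex `x`, so the coefficient would be 1.
  have h1 := DFunLike.congr_fun hb t
  simp only [Finsupp.finsetSum_apply, Finsupp.coe_zero, Pi.zero_apply] at h1
  rw [Finset.sum_eq_single (insert x t), Finset.sum_eq_single x] at h1
  · simp [Finset.erase_insert hx] at h1
  · intro y hy hyx
    refine Finsupp.single_eq_of_ne fun e => ?_
    exact hx (e ▸ Finset.mem_erase.2 ⟨hyx.symm, Finset.mem_insert_self x t⟩)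
  · exact fun h' => absurd (Finset.mem_insert_self x t) h'
  · intro g hg hgT
    obtain ⟨hg1, hg2⟩ := h.mem_generators.1 (hK.mem_toFinset.1 hg)
    refine Finset.sum_eq_zero fun y hy => Finsupp.single_eq_of_ne fun e => ?_
    exact hgT (hno g hg1 hg2 (e ▸ Finset.erase_subset _ _))
  · exact fun h' => absurd (hK.mem_toFinset.2 (h.mem_generators.2 ⟨hT, hn⟩)) h'

/-! ### Gluing a cone along a nondegenerate simplicial map. -/

/-- The vertex map `π` is a nondegenerate simplicial map from `S` to `D`. -/
def Labels (S D : Cplx) (π : ℕ → ℕ) : Prop :=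
  ∀ s ∈ S.faces, s.image π ∈ D.faces ∧ Set.InjOn π (s : Set ℕ)

/-- A simplex or the empty set. -/
def IsFace (K : Cplx) (s : Finset ℕ) : Prop := s = ∅ ∨ s ∈ K.faces

theorem IsFace.mono {K : Cplx} {s t : Finset ℕ} (h : K.IsFace s) (ht : t ⊆ s) : K.IsFace t := by
  rcases t.eq_empty_or_nonempty with h0 | h0
  · exact Or.inl h0
  · rcases h with rfl | h
    · exact Or.inl (Finset.subset_empty.1 ht)
    · exact Or.inr (mem_of_subset h ht h0)

theorem IsFace.mem {K : Cplx} {s : Finset ℕ} (h : K.IsFace s) (hs : s.Nonempty) : s ∈ K.faces :=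
  h.resolve_left hs.ne_empty

theorem Labels.isFace {S D : Cplx} {π : ℕ → ℕ} (h : Labels S D π) {s : Finset ℕ}
    (hs : S.IsFace s) : D.IsFace (s.image π) := by
  rcases hs with rfl | hs
  · exact Or.inl (Finset.image_empty π)
  · exact Or.inr (h s hs).1

theorem Labels.injOn {S D : Cplx} {π : ℕ → ℕ} (h : Labels S D π) {s : Finset ℕ}
    (hs : S.IsFace s) : Set.InjOn π (s : Set ℕ) := by
  rcases hs with rfl | hs
  · simp
  · exact (h s hs).2

/-- The faces of the complex `D` with the cone over `S` glued to it along `π : S → D`: the pairs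
`(τ, ⊥)` with `τ` a face of `D`, and for each face `σ` of `S` the pair `(π σ, σ)`, which stands
for the join of the apex with `σ`. -/
def IsGluedFace (D S : Cplx) (π : ℕ → ℕ) (x : Finset ℕ × WithBot (Finset ℕ)) : Prop :=
  (x.2 = ⊥ ∧ D.IsFace x.1) ∨ ∃ σ : Finset ℕ, S.IsFace σ ∧ x = (σ.image π, (σ : WithBot _))

theorem IsGluedFace.isFace {D S : Cplx} {π : ℕ → ℕ} (h : Labels S D π)
    {x : Finset ℕ × WithBot (Finset ℕ)} (hx : IsGluedFace D S π x) : D.IsFace x.1 := by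
  rcases hx with ⟨-, hx⟩ | ⟨σ, hσ, rfl⟩
  · exact hx
  · exact h.isFace hσ

/-- Since `π` is injective on `σ`, a base face below `a ⋆ σ` is the image of a unique subset of `σ`.
The added bottom element keeps the apex `(∅, ∅)` apart from the empty face `(∅, ⊥)`. -/
theorem glued_boolean {D S : Cplx} {π : ℕ → ℕ} (h : Labels S D π)
    (x : {x : Finset ℕ × WithBot (Finset ℕ) // IsGluedFace D S π x}) :
    ∃ s : Finset ℕ, Nonempty (Set.Iic s ≃o Set.Iic x) := by
  obtain ⟨⟨τ, σ'⟩, ⟨h0, hτ⟩ | ⟨σ, hσ, he⟩⟩ := x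
  · obtain rfl : σ' = ⊥ := h0
    have hτ' : D.IsFace τ := hτ
    let ψ : Set.Iic τ → Set.Iic (⟨(τ, ⊥), Or.inl ⟨rfl, hτ⟩⟩ :
        {x : Finset ℕ × WithBot (Finset ℕ) // IsGluedFace D S π x}) := fun t =>
      ⟨⟨(t.1, ⊥), Or.inl ⟨rfl, hτ'.mono t.2⟩⟩, ⟨t.2, le_rfl⟩⟩
    have hψ : ∀ t t', ψ t ≤ ψ t' ↔ t ≤ t' := fun t t' => ⟨fun h => h.1, fun h => ⟨h, le_rfl⟩⟩
    refine ⟨τ, ⟨RelIso.ofSurjective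
      ⟨⟨ψ, fun t t' h => le_antisymm ((hψ _ _).1 h.le) ((hψ _ _).1 h.ge)⟩, hψ _ _⟩ ?_⟩⟩
    rintro ⟨⟨⟨τ', ρ⟩, hx⟩, hle⟩
    obtain ⟨h1, h2⟩ : τ' ≤ τ ∧ ρ ≤ ⊥ := hle
    obtain rfl := le_bot_iff.1 h2
    exact ⟨⟨τ', h1⟩, rfl⟩
  · obtain ⟨rfl, rfl⟩ := Prod.mk.inj he
    -- The vertex `z` plays the apex: subsets of `insert z σ` containing `z` give the faces through
    -- the apex, the others give faces of the base.
    obtain ⟨z, hz⟩ := Infinite.exists_notMem_finset σ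
    have hinj := h.injOn hσ
    have hsub : ∀ t ⊆ insert z σ, t.erase z ⊆ σ := fun t ht => by
      rw [← Finset.erase_insert hz]
      exact Finset.erase_subset_erase z ht
    let φ : Finset ℕ → Finset ℕ × WithBot (Finset ℕ) := fun t =>
      ((t.erase z).image π, if z ∈ t then ((t.erase z : Finset ℕ) : WithBot _) else ⊥)
    have hφ : ∀ t ⊆ insert z σ, IsGluedFace D S π (φ t) := by
      intro t ht
      by_cases hzt : z ∈ t
      · exact Or.inr ⟨t.erase z, hσ.mono (hsub t ht), by simp [φ, hzt]⟩
      · exact Or.inl ⟨by simp [φ, hzt], h.isFace (hσ.mono (hsub t ht))⟩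
    have hle : ∀ t ⊆ insert z σ, ∀ t' ⊆ insert z σ, (φ t ≤ φ t' ↔ t ⊆ t') := by
      intro t ht t' ht'
      constructor
      · rintro ⟨h1, h2⟩ v hv
        by_cases hvz : v = z
        · subst hvz
          by_contra hn
          simp [φ, hv, hn] at h2
        · have hv' : v ∈ t.erase z := Finset.mem_erase.2 ⟨hvz, hv⟩
          obtain ⟨w, hw, hwv⟩ := Finset.mem_image.1 (h1 (Finset.mem_image_of_mem π hv'))
          have := hinj (hsub t' ht' hw) (hsub t ht hv') hwv
          exact this ▸ Finset.mem_of_mem_erase hw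
      · intro hs
        have hs' := Finset.erase_subset_erase z hs
        refine ⟨Finset.image_subset_image hs', ?_⟩
        by_cases hzt : z ∈ t
        · simpa [φ, hzt, hs hzt] using hs'
        · simp [φ, hzt]
    let ψ : Set.Iic (insert z σ) → Set.Iic (⟨(σ.image π, (σ : WithBot _)), Or.inr ⟨σ, hσ, he⟩⟩ :
        {x : Finset ℕ × WithBot (Finset ℕ) // IsGluedFace D S π x}) := fun t =>
      ⟨⟨φ t.1, hφ _ t.2⟩, by
        refine ⟨Finset.image_subset_image (hsub _ t.2), ?_⟩
        by_cases hzt : z ∈ t.1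
        · simpa [φ, hzt] using hsub _ t.2
        · simp [φ, hzt]⟩
    have hψ : ∀ t t', ψ t ≤ ψ t' ↔ t ≤ t' := fun t t' => hle _ t.2 _ t'.2
    refine ⟨insert z σ, ⟨RelIso.ofSurjective
      ⟨⟨ψ, fun t t' h => le_antisymm ((hψ _ _).1 h.le) ((hψ _ _).1 h.ge)⟩, hψ _ _⟩ ?_⟩⟩
    rintro ⟨⟨⟨τ, ρ⟩, hx⟩, hle⟩
    obtain ⟨h1, h2⟩ : τ ≤ σ.image π ∧ ρ ≤ (σ : WithBot _) := hle
    suffices ∃ t ⊆ insert z σ, φ t = (τ, ρ) by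
      obtain ⟨t, ht, he⟩ := this
      exact ⟨⟨t, ht⟩, Subtype.ext (Subtype.ext he)⟩
    rcases hx with ⟨hx, -⟩ | ⟨α, hα, hx⟩
    · obtain rfl : ρ = ⊥ := hx
      have hn : z ∉ σ.filter (fun v => π v ∈ τ) := fun hm => hz (Finset.mem_filter.1 hm).1
      refine ⟨σ.filter (fun v => π v ∈ τ),
        (Finset.filter_subset _ _).trans (Finset.subset_insert _ _), ?_⟩
      simp only [φ, if_neg hn, Finset.erase_eq_of_notMem hn]
      refine Prod.ext ?_ rfl
      ext q
      simp only [Finset.mem_image, Finset.mem_filter]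
      constructor
      · rintro ⟨v, hv, rfl⟩
        exact hv.2
      · intro hq
        obtain ⟨v, hv, rfl⟩ := Finset.mem_image.1 (h1 hq)
        exact ⟨v, ⟨hv, hq⟩, rfl⟩
    · obtain ⟨rfl, rfl⟩ := Prod.mk.inj hx
      have hασ : α ⊆ σ := WithBot.coe_le_coe.1 h2
      have hzα : z ∉ α := fun hm => hz (hασ hm)
      exact ⟨insert z α, Finset.insert_subset_insert _ hασ, by simp [φ, Finset.erase_insert hzα]⟩

/-- The complex `D` with the cone over `S` glued to it along `π : S → D`. -/
def glued (D S : Cplx) (π : ℕ → ℕ) (h : Labels S D π) : SimplicialPoset where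
  Face := {x : Finset ℕ × WithBot (Finset ℕ) // IsGluedFace D S π x}
  bot := { bot := ⟨(∅, ⊥), Or.inl ⟨rfl, Or.inl rfl⟩⟩
           bot_le := fun x => ⟨Finset.empty_subset x.1.1, bot_le⟩ }
  boolean := glued_boolean h

/-- A face of `glued D S π`. -/
def gluedFace {D S : Cplx} {π : ℕ → ℕ} (h : Labels S D π) (x : Finset ℕ × WithBot (Finset ℕ))
    (hx : IsGluedFace D S π x) : (glued D S π h).Face :=
  ⟨x, hx⟩

/-- A relation that is total on both sides and compatible with the orders is an isomorphism. -/
theorem nonempty_orderIso_of_rel {α β : Type*} [PartialOrder α] [PartialOrder β]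
    (Rel : α → β → Prop) (hl : ∀ x, ∃ z, Rel x z) (hr : ∀ z, ∃ x, Rel x z)
    (hle : ∀ x z x' z', Rel x z → Rel x' z' → (x ≤ x' ↔ z ≤ z')) : Nonempty (β ≃o α) := by
  choose f hf using hl
  choose g hg using hr
  refine ⟨⟨⟨g, f, fun z => ?_, fun x => ?_⟩, fun {z z'} => hle _ _ _ _ (hg z) (hg z')⟩⟩
  · exact le_antisymm ((hle _ _ _ _ (hf (g z)) (hg z)).1 le_rfl)
      ((hle _ _ _ _ (hg z) (hf (g z))).1 le_rfl)
  · exact le_antisymm ((hle _ _ _ _ (hg (f x)) (hf x)).2 le_rfl)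
      ((hle _ _ _ _ (hf x) (hg (f x))).2 le_rfl)

/-! ### Recognising a starring of a glued complex. -/

section Starring

variable (c b : ℕ)

/-- Removes the vertex `c` of `D` and `b` of `S`. -/
def eraseVertex (x : Finset ℕ × WithBot (Finset ℕ)) : Finset ℕ × WithBot (Finset ℕ) :=
  (x.1.erase c, x.2.map fun s => s.erase b)

/-- Adds the vertex `c` of `D` and `b` of `S`. -/
def insertVertex (x : Finset ℕ × WithBot (Finset ℕ)) : Finset ℕ × WithBot (Finset ℕ) :=
  (insert c x.1, x.2.map fun s => insert b s)

variable {c b}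

theorem eraseVertex_mono : Monotone (eraseVertex c b) := fun _ _ h =>
  ⟨Finset.erase_subset_erase _ h.1,
    Monotone.withBot_map (fun _ _ h => Finset.erase_subset_erase _ h) h.2⟩

theorem eraseVertex_eq_self {x : Finset ℕ × WithBot (Finset ℕ)} (h1 : c ∉ x.1)
    (h2 : ∀ σ : Finset ℕ, x.2 = σ → b ∉ σ) : eraseVertex c b x = x := by
  obtain ⟨τ, σ⟩ := x
  refine Prod.ext (Finset.erase_eq_of_notMem h1) ?_
  induction σ using WithBot.recBotCoe with
  | bot => rfl
  | coe σ => exact congrArg WithBot.some (Finset.erase_eq_of_notMem (h2 σ rfl))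

theorem eraseVertex_insertVertex {x : Finset ℕ × WithBot (Finset ℕ)} (h1 : c ∉ x.1)
    (h2 : ∀ σ : Finset ℕ, x.2 = σ → b ∉ σ) : eraseVertex c b (insertVertex c b x) = x := by
  obtain ⟨τ, σ⟩ := x
  refine Prod.ext (Finset.erase_insert h1) ?_
  induction σ using WithBot.recBotCoe with
  | bot => rfl
  | coe σ => exact congrArg WithBot.some (Finset.erase_insert (h2 σ rfl))

/-- A description of the starring of `glued D S π` at `A` as `glued D' S' π'`, when the new vertex
is the vertex `c` of `D'` and `b` is the vertex of `S'` over `c`.  The minimal upper bounds are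
assumed to be given by `q`. -/
theorem nonempty_starring_glued_iso {D S D' S' : Cplx} {π π' : ℕ → ℕ} (h : Labels S D π)
    (h' : Labels S' D' π') (A : (glued D S π h).Face)
    (q : Finset ℕ × WithBot (Finset ℕ) → Finset ℕ × WithBot (Finset ℕ)) (hq : Monotone q)
    (hbc : ∀ x, IsGluedFace D' S' π' x → ∀ σ : Finset ℕ, x.2 = σ → (b ∈ σ ↔ c ∈ x.1))
    (h1 : ∀ x, IsGluedFace D' S' π' x →
      IsGluedFace D S π (eraseVertex c b x) ∧ ¬ A.1 ≤ eraseVertex c b x)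
    (h2 : ∀ x, IsGluedFace D' S' π' x → c ∈ x.1 → IsGluedFace D S π (q x) ∧ A.1 ≤ q x ∧
      eraseVertex c b x ≤ q x ∧
      ∀ y, IsGluedFace D S π y → A.1 ≤ y → eraseVertex c b x ≤ y → q x ≤ y)
    (h3 : ∀ u, IsGluedFace D S π u → ¬ A.1 ≤ u →
      IsGluedFace D' S' π' u ∧ c ∉ u.1 ∧ ∀ σ : Finset ℕ, u.2 = σ → b ∉ σ)
    (h4 : ∀ u y, IsGluedFace D S π u → ¬ A.1 ≤ u → IsGluedFace D S π y → u ≤ y → A.1 ≤ y →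
      IsGluedFace D' S' π' (insertVertex c b u)) :
    Nonempty ((glued D S π h).Starring A ≃o (glued D' S' π' h').Face) := by
  -- A face through the new vertex `c` corresponds to its opposite face together with the upper
  -- bound given by `q`; a face without `c` is kept, with `⊥` as second entry.
  let Rel : (glued D' S' π' h').Face → (glued D S π h).Starring A → Prop := fun x z =>
    z.1.1.1 = eraseVertex c b x.1 ∧ ((c ∉ x.1.1 ∧ z.1.2 = ⊥) ∨
      (c ∈ x.1.1 ∧ ∃ p : (glued D S π h).Face, z.1.2 = p ∧ p.1 = q x.1))
  refine nonempty_orderIso_of_rel Rel ?_ ?_ ?_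
  · intro x
    obtain ⟨e1, e2⟩ := h1 x.1 x.2
    by_cases hc : c ∈ x.1.1
    · obtain ⟨q1, q2, q3, q4⟩ := h2 x.1 x.2 hc
      let p : (glued D S π h).Face := ⟨q x.1, q1⟩
      have hp : ∀ σ : (glued D S π h).Face, (p : WithBot (glued D S π h).Face) = σ →
          Minimal (fun ρ : (glued D S π h).Face => ⟨_, e1⟩ ≤ ρ ∧ A ≤ ρ) σ := by
        intro σ hσ
        obtain rfl := WithBot.coe_injective hσ
        exact ⟨⟨q3, q2⟩, fun y hy _ => q4 y.1 y.2 hy.2 hy.1⟩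
      exact ⟨⟨(⟨_, e1⟩, p), e2, hp⟩, rfl, Or.inr ⟨hc, p, rfl, rfl⟩⟩
    · refine ⟨⟨(⟨_, e1⟩, ⊥), e2, ?_⟩, rfl, Or.inl ⟨hc, rfl⟩⟩
      intro σ hσ
      exact absurd hσ.symm (WithBot.coe_ne_bot)
  · rintro ⟨⟨u, y⟩, hu, hy⟩
    obtain ⟨u1, u2, u3⟩ := h3 u.1 u.2 hu
    induction y using WithBot.recBotCoe with
    | bot => exact ⟨⟨u.1, u1⟩, (eraseVertex_eq_self u2 u3).symm, Or.inl ⟨u2, rfl⟩⟩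
    | coe y =>
      have hmin : Minimal (fun ρ => u ≤ ρ ∧ A ≤ ρ) y := hy y rfl
      have hx := h4 u.1 y.1 u.2 hu y.2 hmin.1.1 hmin.1.2
      have hc : c ∈ (insertVertex c b u.1).1 := Finset.mem_insert_self _ _
      have he := eraseVertex_insertVertex (c := c) (b := b) u2 u3
      obtain ⟨q1, q2, q3, q4⟩ := h2 _ hx hc
      rw [he] at q3 q4
      refine ⟨⟨_, hx⟩, he.symm, Or.inr ⟨hc, y, rfl, ?_⟩⟩
      -- By `h2` the upper bounds have a least element, so the minimal upper bound `y` has to be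
      -- that one.
      have hqy := q4 y.1 y.2 hmin.1.2 hmin.1.1
      have hyq : y ≤ ⟨_, q1⟩ := hmin.2 (y := ⟨_, q1⟩) ⟨q3, q2⟩ hqy
      exact le_antisymm hyq hqy
  · rintro x ⟨⟨u, y⟩, hu, hy⟩ x' ⟨⟨u', y'⟩, hu', hy'⟩ ⟨r1, r2⟩ ⟨r1', r2'⟩
    replace r1 : u.1 = eraseVertex c b x.1 := r1
    replace r1' : u'.1 = eraseVertex c b x'.1 := r1'
    change x.1 ≤ x'.1 ↔ (u.1 ≤ u'.1 ∧ y ≤ y')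
    rw [r1, r1']
    constructor
    · intro hxx
      refine ⟨eraseVertex_mono hxx, ?_⟩
      rcases r2 with ⟨-, r2⟩ | ⟨hc, p, r2, hp⟩
      · obtain rfl : y = ⊥ := r2
        exact bot_le
      · obtain rfl : y = p := r2
        rcases r2' with ⟨hc', -⟩ | ⟨-, p', r2', hp'⟩
        · exact absurd (hxx.1 hc) hc'
        · obtain rfl : y' = p' := r2'
          refine WithBot.coe_le_coe.2 ?_
          change p.1 ≤ p'.1
          rw [hp, hp']
          exact hq hxx
    · rintro ⟨hux, hyy⟩
      -- Removing `c` and `b` forgets whether the new vertex was present; the second entry of the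
      -- pair, `⊥` or not, remembers it.
      have hc : c ∈ x.1.1 → c ∈ x'.1.1 := by
        intro hc
        rcases r2 with ⟨hc', -⟩ | ⟨-, p, r2, hp⟩
        · exact absurd hc hc'
        · obtain rfl : y = p := r2
          rcases r2' with ⟨-, r2'⟩ | ⟨hc', -⟩
          · obtain rfl : y' = ⊥ := r2'
            exact absurd (le_bot_iff.1 hyy) WithBot.coe_ne_bot
          · exact hc'
      obtain ⟨⟨τ, σ⟩, hx⟩ := x
      obtain ⟨⟨τ', σ'⟩, hx'⟩ := x'
      obtain ⟨l1, l2⟩ := hux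
      refine ⟨fun v hv => ?_, ?_⟩
      · by_cases hvc : v = c
        · exact hvc ▸ hc (hvc ▸ hv)
        · exact Finset.mem_of_mem_erase (l1 (Finset.mem_erase.2 ⟨hvc, hv⟩))
      · change σ ≤ σ'
        induction σ using WithBot.recBotCoe with
        | bot => exact bot_le
        | coe σ =>
          induction σ' using WithBot.recBotCoe with
          | bot => exact absurd (le_bot_iff.1 l2) WithBot.coe_ne_bot
          | coe σ' =>
            refine WithBot.coe_le_coe.2 fun v hv => ?_
            by_cases hvb : v = b
            · subst hvb
              exact (hbc _ hx' σ' rfl).2 (hc ((hbc _ hx σ rfl).1 hv))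
            · exact Finset.mem_of_mem_erase
                (WithBot.coe_le_coe.1 l2 (Finset.mem_erase.2 ⟨hvb, hv⟩))

end Starring

/-! ### The 2-3 move. -/

/-- The simplices of `D` that do not contain `t`. -/
def delete (t : Finset ℕ) (D : Cplx) : Cplx where
  faces := {s | s ∈ D.faces ∧ ¬ t ⊆ s}
  isRelLowerSet_faces := fun _ hs => ⟨nonempty_of_mem hs.1, fun _ hts ht =>
    ⟨mem_of_subset hs.1 hts ht, fun h => hs.2 (h.trans hts)⟩⟩

/-- The situation of a 2-3 move: the simplex `t = π σ₀` of `D` lies in the simplex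
`insert w t` of `D` and in the join of the apex with `σ₀`, and in no other maximal simplex. -/
structure IsFlip (D S : Cplx) (π : ℕ → ℕ) (σ₀ : Finset ℕ) (w b : ℕ) : Prop where
  labels : Labels S D π
  mem : σ₀ ∈ S.faces
  eq_of_subset : ∀ σ ∈ S.faces, σ₀.image π ⊆ σ.image π → σ = σ₀
  notMem : w ∉ σ₀.image π
  insert_mem : insert w (σ₀.image π) ∈ D.faces
  subset_of : ∀ s ∈ D.faces, σ₀.image π ⊆ s → s ⊆ insert w (σ₀.image π)
  fresh : b ∉ S.vertices

namespace IsFlip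

variable {D S : Cplx} {π : ℕ → ℕ} {σ₀ : Finset ℕ} {w b c : ℕ}

theorem nonempty (h : IsFlip D S π σ₀ w b) : σ₀.Nonempty := nonempty_of_mem h.mem

theorem notMem_of_isFace (h : IsFlip D S π σ₀ w b) {σ : Finset ℕ} (hσ : S.IsFace σ) : b ∉ σ := by
  rcases hσ with rfl | hσ
  · exact Finset.notMem_empty b
  · exact notMem_of_mem_faces h.fresh hσ

theorem eq_of_isFace (h : IsFlip D S π σ₀ w b) {σ : Finset ℕ} (hσ : S.IsFace σ)
    (hs : σ₀.image π ⊆ σ.image π) : σ = σ₀ := by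
  rcases hσ with rfl | hσ
  · rw [Finset.image_empty, Finset.subset_empty, Finset.image_eq_empty] at hs
    exact hs.symm
  · exact h.eq_of_subset σ hσ hs

theorem not_subset_image (h : IsFlip D S π σ₀ w b) {α : Finset ℕ} (hα : α ⊂ σ₀) :
    ¬ σ₀.image π ⊆ α.image π := by
  intro hs
  refine hα.2 fun v hv => ?_
  obtain ⟨u, hu, he⟩ := Finset.mem_image.1 (hs (Finset.mem_image_of_mem π hv))
  exact (h.labels _ h.mem).2 (hα.1 hu) hv he ▸ hu

/-- By `eq_of_subset` the simplex `σ₀` is maximal in `S`, so its link is empty and the starring only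
replaces it by the cone from `b` over its boundary. -/
theorem isFace_subdivide (h : IsFlip D S π σ₀ w b) {σ : Finset ℕ} :
    (subdivide σ₀ b S).IsFace σ ↔
      (S.IsFace σ ∧ σ ≠ σ₀) ∨ ∃ α ⊂ σ₀, σ = insert b α := by
  constructor
  · rintro (rfl | hσ)
    · exact Or.inl ⟨Or.inl rfl, h.nonempty.ne_empty.symm⟩
    · by_cases hb : b ∈ σ
      · obtain ⟨α, hα, rfl⟩ := eq_insert_erase_of_mem hb
        obtain ⟨h1, h2⟩ := (insert_mem_subdivide h.fresh hα).1 hσ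
        have h3 := h.eq_of_subset _ h2 (Finset.image_subset_image Finset.subset_union_left)
        exact Or.inr ⟨α, ⟨Finset.union_eq_left.1 h3, h1⟩, rfl⟩
      · obtain ⟨h1, h2⟩ := (mem_subdivide_of_notMem hb).1 hσ
        exact Or.inl ⟨Or.inr h1, fun he => h2 he.symm.subset⟩
  · rintro (⟨hσ, hne⟩ | ⟨α, hα, rfl⟩)
    · rcases hσ with rfl | hσ
      · exact Or.inl rfl
      · exact Or.inr (Or.inl ⟨hσ, fun hs =>
          hne (h.eq_of_subset σ hσ (Finset.image_subset_image hs))⟩)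
    · refine Or.inr ((insert_mem_subdivide h.fresh fun hb =>
        notMem_of_mem_faces h.fresh h.mem (hα.1 hb)).2 ⟨hα.2, ?_⟩)
      rw [Finset.union_eq_left.2 hα.1]
      exact h.mem

theorem image_update (h : IsFlip D S π σ₀ w b) {σ : Finset ℕ} (hσ : S.IsFace σ) (d : ℕ) :
    σ.image (Function.update π b d) = σ.image π := by
  refine Finset.image_congr fun v hv => Function.update_of_ne ?_ _ _
  rintro rfl
  exact h.notMem_of_isFace hσ hv

theorem image_update_insert (h : IsFlip D S π σ₀ w b) {α : Finset ℕ} (hα : α ⊂ σ₀) (d : ℕ) :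
    (insert b α).image (Function.update π b d) = insert d (α.image π) := by
  rw [Finset.image_insert, Function.update_self, h.image_update (IsFace.mono (Or.inr h.mem) hα.1)]

/-- The label `d` of `b` is kept free to serve two purposes: `d = w` for the result of the move and
`d = c` for the common starring. -/
theorem labels_update (h : IsFlip D S π σ₀ w b) {D' : Cplx} {d : ℕ} (hd : d ∉ σ₀.image π)
    (h1 : ∀ s ∈ D.faces, ¬ σ₀.image π ⊆ s → s ∈ D'.faces)
    (h2 : ∀ α ⊂ σ₀, insert d (α.image π) ∈ D'.faces) :
    Labels (subdivide σ₀ b S) D' (Function.update π b d) := by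
  intro σ hσ
  rcases h.isFace_subdivide.1 (Or.inr hσ) with ⟨hσ', hne⟩ | ⟨α, hα, rfl⟩
  · have hσ'' := hσ'.mem (nonempty_of_mem hσ)
    refine ⟨?_, ?_⟩
    · rw [h.image_update hσ']
      exact h1 _ (h.labels σ hσ'').1 fun hs => hne (h.eq_of_subset σ hσ'' hs)
    · refine (h.labels σ hσ'').2.congr fun v hv => (Function.update_of_ne ?_ _ _).symm
      rintro rfl
      exact h.notMem_of_isFace hσ' hv
  · have hbα : b ∉ α := fun hb => notMem_of_mem_faces h.fresh h.mem (hα.1 hb)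
    refine ⟨by rw [h.image_update_insert hα]; exact h2 α hα, ?_⟩
    rw [Finset.coe_insert, Set.injOn_insert (by simpa using hbα)]
    refine ⟨((h.labels _ h.mem).2.mono hα.1).congr fun v hv => (Function.update_of_ne ?_ _ _).symm,
      ?_⟩
    · rintro rfl
      exact hbα hv
    · rw [Function.update_self]
      rintro ⟨v, hv, he⟩
      rw [Function.update_of_ne (by rintro rfl; exact hbα hv)] at he
      exact hd (he ▸ Finset.mem_image_of_mem π (hα.1 hv))

theorem isGluedFace_update (h : IsFlip D S π σ₀ w b) {D' : Cplx} {d : ℕ}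
    {x : Finset ℕ × WithBot (Finset ℕ)} :
    IsGluedFace D' (subdivide σ₀ b S) (Function.update π b d) x ↔
      (x.2 = ⊥ ∧ D'.IsFace x.1) ∨
      (∃ σ : Finset ℕ, S.IsFace σ ∧ σ ≠ σ₀ ∧ x = (σ.image π, (σ : WithBot _))) ∨
      ∃ α ⊂ σ₀, x = (insert d (α.image π), ((insert b α : Finset ℕ) : WithBot _)) := by
  refine or_congr Iff.rfl ⟨?_, ?_⟩
  · rintro ⟨σ, hσ, rfl⟩
    rcases h.isFace_subdivide.1 hσ with ⟨hσ', hne⟩ | ⟨α, hα, rfl⟩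
    · exact Or.inl ⟨σ, hσ', hne, by rw [h.image_update hσ']⟩
    · exact Or.inr ⟨α, hα, by rw [h.image_update_insert hα]⟩
  · rintro (⟨σ, hσ, hne, rfl⟩ | ⟨α, hα, rfl⟩)
    · exact ⟨σ, h.isFace_subdivide.2 (Or.inl ⟨hσ, hne⟩), by rw [h.image_update hσ]⟩
    · exact ⟨_, h.isFace_subdivide.2 (Or.inr ⟨α, hα, rfl⟩), by rw [h.image_update_insert hα]⟩

theorem image_mem (h : IsFlip D S π σ₀ w b) : σ₀.image π ∈ D.faces := (h.labels _ h.mem).1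

/-- By `subset_of` every simplex of `D` over `σ₀.image π` lies in the simplex spanned by it and `w`,
so the new simplices are cones over faces of that one simplex. -/
theorem isFace_subdivide_image (h : IsFlip D S π σ₀ w b) (hc : c ∉ D.vertices) {τ : Finset ℕ} :
    (subdivide (σ₀.image π) c D).IsFace τ ↔ (D.IsFace τ ∧ ¬ σ₀.image π ⊆ τ) ∨
      ∃ β ⊆ insert w (σ₀.image π), ¬ σ₀.image π ⊆ β ∧ τ = insert c β := by
  constructor
  · rintro (rfl | hτ)
    · refine Or.inl ⟨Or.inl rfl, fun hs => ?_⟩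
      exact (h.nonempty.image π).ne_empty (Finset.subset_empty.1 hs)
    · by_cases hcτ : c ∈ τ
      · obtain ⟨β, hβ, rfl⟩ := eq_insert_erase_of_mem hcτ
        obtain ⟨h1, h2⟩ := (insert_mem_subdivide hc hβ).1 hτ
        exact Or.inr ⟨β, Finset.subset_union_right.trans
          (h.subset_of _ h2 Finset.subset_union_left), h1, rfl⟩
      · obtain ⟨h1, h2⟩ := (mem_subdivide_of_notMem hcτ).1 hτ
        exact Or.inl ⟨Or.inr h1, h2⟩
  · rintro (⟨hτ, hn⟩ | ⟨β, hβ, hn, rfl⟩)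
    · rcases hτ with rfl | hτ
      · exact Or.inl rfl
      · exact Or.inr (Or.inl ⟨hτ, hn⟩)
    · refine Or.inr ((insert_mem_subdivide hc fun hm =>
        notMem_of_mem_faces hc h.insert_mem (hβ hm)).2 ⟨hn, ?_⟩)
      exact mem_of_subset h.insert_mem (Finset.union_subset (Finset.subset_insert _ _) hβ)
        ((h.nonempty.image π).mono Finset.subset_union_left)

theorem notMem_of_subset (h : IsFlip D S π σ₀ w b) (hc : c ∉ D.vertices) {β : Finset ℕ}
    (hβ : β ⊆ insert w (σ₀.image π)) : c ∉ β := fun hm =>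
  notMem_of_mem_faces hc h.insert_mem (hβ hm)

/-- The faces of the common starring of both sides of a 2-3 move. -/
theorem isGluedFace_starring (h : IsFlip D S π σ₀ w b) (hc : c ∉ D.vertices)
    {x : Finset ℕ × WithBot (Finset ℕ)} :
    IsGluedFace (subdivide (σ₀.image π) c D) (subdivide σ₀ b S) (Function.update π b c) x ↔
      (∃ τ, D.IsFace τ ∧ ¬ σ₀.image π ⊆ τ ∧ x = (τ, ⊥)) ∨
      (∃ β ⊆ insert w (σ₀.image π), ¬ σ₀.image π ⊆ β ∧ x = (insert c β, ⊥)) ∨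
      (∃ σ : Finset ℕ, S.IsFace σ ∧ σ ≠ σ₀ ∧ x = (σ.image π, (σ : WithBot _))) ∨
      ∃ α ⊂ σ₀, x = (insert c (α.image π), ((insert b α : Finset ℕ) : WithBot _)) := by
  rw [h.isGluedFace_update, h.isFace_subdivide_image hc, ← or_assoc (a := ∃ τ, _)]
  refine or_congr ⟨?_, ?_⟩ Iff.rfl
  · obtain ⟨τ, σ⟩ := x
    rintro ⟨h1, ⟨h2, h3⟩ | ⟨β, h2, h3, h4⟩⟩
    · exact Or.inl ⟨τ, h2, h3, Prod.ext rfl h1⟩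
    · exact Or.inr ⟨β, h2, h3, Prod.ext h4 h1⟩
  · rintro (⟨τ, h2, h3, rfl⟩ | ⟨β, h2, h3, rfl⟩)
    · exact ⟨rfl, Or.inl ⟨h2, h3⟩⟩
    · exact ⟨rfl, Or.inr ⟨β, h2, h3, rfl⟩⟩

/-- The result of the 2-3 move. -/
theorem isGluedFace_flip (h : IsFlip D S π σ₀ w b) {x : Finset ℕ × WithBot (Finset ℕ)} :
    IsGluedFace (delete (σ₀.image π) D) (subdivide σ₀ b S) (Function.update π b w) x ↔
      (∃ τ, D.IsFace τ ∧ ¬ σ₀.image π ⊆ τ ∧ x = (τ, ⊥)) ∨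
      (∃ σ : Finset ℕ, S.IsFace σ ∧ σ ≠ σ₀ ∧ x = (σ.image π, (σ : WithBot _))) ∨
      ∃ α ⊂ σ₀, x = (insert w (α.image π), ((insert b α : Finset ℕ) : WithBot _)) := by
  rw [h.isGluedFace_update]
  refine or_congr ⟨?_, ?_⟩ Iff.rfl
  · obtain ⟨τ, σ⟩ := x
    rintro ⟨h1, h2 | h2⟩
    · obtain rfl : τ = ∅ := h2
      refine ⟨∅, Or.inl rfl, fun hs => ?_, Prod.ext rfl h1⟩
      exact (h.nonempty.image π).ne_empty (Finset.subset_empty.1 hs)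
    · exact ⟨τ, Or.inr h2.1, h2.2, Prod.ext rfl h1⟩
  · rintro ⟨τ, h2, h3, rfl⟩
    refine ⟨rfl, ?_⟩
    rcases h2 with rfl | h2
    · exact Or.inl rfl
    · exact Or.inr ⟨h2, h3⟩

theorem labels_starring (h : IsFlip D S π σ₀ w b) (hc : c ∉ D.vertices) :
    Labels (subdivide σ₀ b S) (subdivide (σ₀.image π) c D) (Function.update π b c) := by
  refine h.labels_update (notMem_of_mem_faces hc h.image_mem) (fun s hs hn => Or.inl ⟨hs, hn⟩) ?_
  intro α hα
  exact ((h.isFace_subdivide_image hc).2 (Or.inr ⟨α.image π,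
    (Finset.image_subset_image hα.1).trans (Finset.subset_insert _ _),
    h.not_subset_image hα, rfl⟩)).mem (Finset.insert_nonempty _ _)

theorem not_subset_insert (h : IsFlip D S π σ₀ w b) {α : Finset ℕ} (hα : α ⊂ σ₀) :
    ¬ σ₀.image π ⊆ insert w (α.image π) := fun hs =>
  h.not_subset_image hα ((Finset.subset_insert_iff_of_notMem h.notMem).1 hs)

theorem labels_flip (h : IsFlip D S π σ₀ w b) :
    Labels (subdivide σ₀ b S) (delete (σ₀.image π) D) (Function.update π b w) := by
  refine h.labels_update h.notMem (fun s hs hn => ⟨hs, hn⟩) fun α hα => ⟨?_, ?_⟩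
  · exact mem_of_subset h.insert_mem (Finset.insert_subset_insert _
      (Finset.image_subset_image hα.1)) (Finset.insert_nonempty _ _)
  · exact h.not_subset_insert hα

theorem mem_iff_mem (h : IsFlip D S π σ₀ w b) (hc : c ∉ D.vertices)
    {x : Finset ℕ × WithBot (Finset ℕ)} (hx : IsGluedFace (subdivide (σ₀.image π) c D)
      (subdivide σ₀ b S) (Function.update π b c) x) (σ : Finset ℕ) (hσ : x.2 = σ) :
    b ∈ σ ↔ c ∈ x.1 := by
  rcases (h.isGluedFace_starring hc).1 hx with ⟨τ, _, _, rfl⟩ | ⟨β, _, _, rfl⟩ |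
    ⟨σ', hσ', _, rfl⟩ | ⟨α, hα, rfl⟩
  · exact absurd hσ.symm WithBot.coe_ne_bot
  · exact absurd hσ.symm WithBot.coe_ne_bot
  · obtain rfl := WithBot.coe_injective hσ
    refine iff_of_false (h.notMem_of_isFace hσ') fun hm => ?_
    obtain ⟨v, hv, -⟩ := Finset.mem_image.1 hm
    exact notMem_of_mem_faces hc (h.labels σ' (hσ'.mem ⟨v, hv⟩)).1 hm
  · obtain rfl := WithBot.coe_injective hσ
    exact iff_of_true (Finset.mem_insert_self _ _) (Finset.mem_insert_self _ _)

theorem notMem_of_isFace_base (hc : c ∉ D.vertices) {τ : Finset ℕ} (hτ : D.IsFace τ) : c ∉ τ := by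
  rcases hτ with rfl | hτ
  · exact Finset.notMem_empty c
  · exact notMem_of_mem_faces hc hτ

/-- The vertex-removed faces of the common starring. -/
theorem eraseVertex_cases (h : IsFlip D S π σ₀ w b) (hc : c ∉ D.vertices)
    {x : Finset ℕ × WithBot (Finset ℕ)} (hx : IsGluedFace (subdivide (σ₀.image π) c D)
      (subdivide σ₀ b S) (Function.update π b c) x) :
    (∃ τ, D.IsFace τ ∧ ¬ σ₀.image π ⊆ τ ∧ eraseVertex c b x = (τ, ⊥)) ∨
      ∃ σ : Finset ℕ, S.IsFace σ ∧ σ ≠ σ₀ ∧ eraseVertex c b x = (σ.image π, (σ : WithBot _)) := by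
  rcases (h.isGluedFace_starring hc).1 hx with ⟨τ, h1, h2, rfl⟩ | ⟨β, h1, h2, rfl⟩ |
    ⟨σ', h1, h2, rfl⟩ | ⟨α, hα, rfl⟩
  · exact Or.inl ⟨τ, h1, h2, Prod.ext
      (Finset.erase_eq_of_notMem (notMem_of_isFace_base hc h1)) rfl⟩
  · exact Or.inl ⟨β, IsFace.mono (Or.inr h.insert_mem) h1, h2,
      Prod.ext (Finset.erase_insert (h.notMem_of_subset hc h1)) rfl⟩
  · exact Or.inr ⟨σ', h1, h2, Prod.ext (Finset.erase_eq_of_notMem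
      (notMem_of_isFace_base hc (h.labels.isFace h1)))
      (congrArg WithBot.some (Finset.erase_eq_of_notMem (h.notMem_of_isFace h1)))⟩
  · have hα' : S.IsFace α := IsFace.mono (Or.inr h.mem) hα.1
    exact Or.inr ⟨α, hα', hα.ne, Prod.ext (Finset.erase_insert
      (notMem_of_isFace_base hc (h.labels.isFace hα')))
      (congrArg WithBot.some (Finset.erase_insert (h.notMem_of_isFace hα')))⟩

/-- Here the starring is at `t = σ₀.image π`. A base face `τ` and `t` have the least upper bound `τ
∪ t`. A face `a ⋆ α` can only be bounded together with `t` by `a ⋆ σ₀`, because `σ₀` is the only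
simplex of `S` whose image contains `t`. -/
theorem starring_iso (h : IsFlip D S π σ₀ w b) (hc : c ∉ D.vertices) :
    Nonempty ((glued D S π h.labels).Starring
      (gluedFace h.labels (σ₀.image π, ⊥) (Or.inl ⟨rfl, Or.inr h.image_mem⟩)) ≃o
      (glued _ _ _ (h.labels_starring hc)).Face) := by
  refine nonempty_starring_glued_iso (c := c) (b := b) _ _ _
    (fun x => (σ₀.image π ∪ x.1.erase c, x.2.map fun _ => σ₀)) ?_
    (fun x hx σ hσ => h.mem_iff_mem hc hx σ hσ) ?_ ?_ ?_ ?_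
  · intro x y hxy
    exact ⟨Finset.union_subset_union_right (Finset.erase_subset_erase _ hxy.1),
      Monotone.withBot_map monotone_const hxy.2⟩
  · intro x hx
    rcases h.eraseVertex_cases hc hx with ⟨τ, h1, h2, he⟩ | ⟨σ, h1, h2, he⟩ <;> rw [he]
    · exact ⟨Or.inl ⟨rfl, h1⟩, fun hle => h2 hle.1⟩
    · exact ⟨Or.inr ⟨σ, h1, rfl⟩, fun hle => h2 (h.eq_of_isFace h1 hle.1)⟩
  · intro x hx hcx
    rcases (h.isGluedFace_starring hc).1 hx with ⟨τ, h1, h2, rfl⟩ | ⟨β, h1, h2, rfl⟩ |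
      ⟨σ', h1, h2, rfl⟩ | ⟨α, hα, rfl⟩
    · exact absurd hcx (notMem_of_isFace_base hc h1)
    · have he : (insert c β).erase c = β := Finset.erase_insert (h.notMem_of_subset hc h1)
      refine ⟨Or.inl ⟨rfl, ?_⟩, ⟨?_, bot_le⟩, ⟨?_, bot_le⟩, fun y hy hAy hxy => ⟨?_, bot_le⟩⟩
      · simp only [he]
        exact IsFace.mono (Or.inr h.insert_mem)
          (Finset.union_subset (Finset.subset_insert _ _) h1)
      · exact Finset.subset_union_left
      · exact Finset.subset_union_right
      · exact Finset.union_subset hAy.1 hxy.1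
    · exact absurd hcx (notMem_of_isFace_base hc (h.labels.isFace h1))
    · have hα' : S.IsFace α := IsFace.mono (Or.inr h.mem) hα.1
      have he : (insert c (α.image π)).erase c = α.image π :=
        Finset.erase_insert (notMem_of_isFace_base hc (h.labels.isFace hα'))
      have he' : σ₀.image π ∪ α.image π = σ₀.image π :=
        Finset.union_eq_left.2 (Finset.image_subset_image hα.1)
      have hx' : eraseVertex c b (insert c (α.image π), ((insert b α : Finset ℕ) : WithBot _)) =
          (α.image π, (α : WithBot _)) :=
        Prod.ext he (congrArg WithBot.some (Finset.erase_insert (h.notMem_of_isFace hα')))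
      simp only [he, he', hx']
      refine ⟨Or.inr ⟨σ₀, Or.inr h.mem, rfl⟩, ⟨subset_rfl, bot_le⟩,
        ⟨Finset.image_subset_image hα.1, WithBot.coe_le_coe.2 hα.1⟩, ?_⟩
      rintro y (⟨hy, -⟩ | ⟨σ, hσ, rfl⟩) hAy hxy
      · exact absurd (le_bot_iff.1 (hy ▸ hxy.2)) WithBot.coe_ne_bot
      · rw [h.eq_of_isFace hσ hAy.1]
        exact le_rfl
  · rintro u (⟨h1, h2⟩ | ⟨σ, hσ, rfl⟩) hu
    · obtain ⟨τ, ρ⟩ := u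
      obtain rfl : ρ = ⊥ := h1
      refine ⟨(h.isGluedFace_starring hc).2 (Or.inl ⟨τ, h2, fun hs => hu ⟨hs, le_rfl⟩, rfl⟩),
        notMem_of_isFace_base hc h2, fun σ hσ => absurd hσ.symm WithBot.coe_ne_bot⟩
    · have hne : σ ≠ σ₀ := by
        rintro rfl
        exact hu ⟨subset_rfl, bot_le⟩
      refine ⟨(h.isGluedFace_starring hc).2 (Or.inr (Or.inr (Or.inl ⟨σ, hσ, hne, rfl⟩))),
        notMem_of_isFace_base hc (h.labels.isFace hσ), fun σ' hσ' => ?_⟩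
      obtain rfl := WithBot.coe_injective hσ'
      exact h.notMem_of_isFace hσ
  · rintro u y (⟨h1, h2⟩ | ⟨σ, hσ, rfl⟩) hu hy huy hAy
    · obtain ⟨τ, ρ⟩ := u
      obtain rfl : ρ = ⊥ := h1
      refine (h.isGluedFace_starring hc).2 (Or.inr (Or.inl
        ⟨τ, ?_, fun hs => hu ⟨hs, le_rfl⟩, rfl⟩))
      have hyD := (hy.isFace h.labels).mem ((h.nonempty.image π).mono hAy.1)
      exact (show τ ⊆ y.1 from huy.1).trans (h.subset_of _ hyD hAy.1)
    · rcases hy with ⟨hy, -⟩ | ⟨σ', hσ', rfl⟩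
      · exact absurd (le_bot_iff.1 (hy ▸ huy.2)) WithBot.coe_ne_bot
      · obtain rfl := h.eq_of_isFace hσ' hAy.1
        refine (h.isGluedFace_starring hc).2 (Or.inr (Or.inr (Or.inr
          ⟨σ, ⟨WithBot.coe_le_coe.1 huy.2, fun hs => hu ?_⟩, rfl⟩)))
        exact ⟨Finset.image_subset_image hs, bot_le⟩

theorem isGluedFace_edge (h : IsFlip D S π σ₀ w b) :
    IsGluedFace (delete (σ₀.image π) D) (subdivide σ₀ b S) (Function.update π b w)
      ({w}, (({b} : Finset ℕ) : WithBot _)) :=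
  h.isGluedFace_flip.2 (Or.inr (Or.inr ⟨∅, Finset.empty_ssubset.2 h.nonempty, by simp⟩))

/-- The faces over the new edge of the result of the 2-3 move. -/
theorem cases_of_edge_le (h : IsFlip D S π σ₀ w b) {y : Finset ℕ × WithBot (Finset ℕ)}
    (hy : IsGluedFace (delete (σ₀.image π) D) (subdivide σ₀ b S) (Function.update π b w) y)
    (hle : ({w}, (({b} : Finset ℕ) : WithBot _)) ≤ y) :
    ∃ α ⊂ σ₀, y = (insert w (α.image π), ((insert b α : Finset ℕ) : WithBot _)) := by
  rcases h.isGluedFace_flip.1 hy with ⟨τ, _, _, rfl⟩ | ⟨σ, hσ, _, rfl⟩ | h'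
  · exact absurd (le_bot_iff.1 hle.2) WithBot.coe_ne_bot
  · exact absurd (WithBot.coe_le_coe.1 hle.2 (Finset.mem_singleton_self b))
      (h.notMem_of_isFace hσ)
  · exact h'

/-- Here the starring is at the edge from the apex to `b`. The faces over this edge are its joins
with the proper faces of `σ₀`, so least upper bounds are found by determining the required proper
face. -/
theorem starring_flip_iso (h : IsFlip D S π σ₀ w b) (hc : c ∉ D.vertices) :
    Nonempty ((glued _ _ _ h.labels_flip).Starring
      (gluedFace h.labels_flip _ h.isGluedFace_edge) ≃o
      (glued _ _ _ (h.labels_starring hc)).Face) := by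
  have hb₀ : b ∉ σ₀ := notMem_of_mem_faces h.fresh h.mem
  have filter_ssubset : ∀ β : Finset ℕ, ¬ σ₀.image π ⊆ β → c ∉ σ₀.image π →
      σ₀.filter (fun v => π v ∈ insert c β) ⊂ σ₀ := by
    intro β hβ hcσ
    refine ⟨Finset.filter_subset _ _, fun hs => hβ fun v hv => ?_⟩
    obtain ⟨u, hu, rfl⟩ := Finset.mem_image.1 hv
    refine Finset.mem_of_mem_insert_of_ne (Finset.mem_filter.1 (hs hu)).2 ?_
    rintro rfl
    exact hcσ hv
  have hcσ := notMem_of_mem_faces hc h.image_mem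
  -- The filter selects the part of `σ₀` whose labels occur in the given face. The label `c` may
  -- stay in the test since it does not occur on `σ₀`.
  refine nonempty_starring_glued_iso (c := c) (b := b) _ _ _
    (fun x => (insert w (x.1.erase c),
      ((insert b (σ₀.filter fun v => π v ∈ x.1) : Finset ℕ) : WithBot _))) ?_
    (fun x hx σ hσ => h.mem_iff_mem hc hx σ hσ) ?_ ?_ ?_ ?_
  · intro x y hxy
    refine ⟨Finset.insert_subset_insert _ (Finset.erase_subset_erase _ hxy.1),
      WithBot.coe_le_coe.2 (Finset.insert_subset_insert _ fun v hv => ?_)⟩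
    rw [Finset.mem_filter] at hv ⊢
    exact ⟨hv.1, hxy.1 hv.2⟩
  · intro x hx
    rcases h.eraseVertex_cases hc hx with ⟨τ, h1, h2, he⟩ | ⟨σ, h1, h2, he⟩ <;> rw [he]
    · exact ⟨h.isGluedFace_flip.2 (Or.inl ⟨τ, h1, h2, rfl⟩),
        fun hle => absurd (le_bot_iff.1 hle.2) WithBot.coe_ne_bot⟩
    · exact ⟨h.isGluedFace_flip.2 (Or.inr (Or.inl ⟨σ, h1, h2, rfl⟩)), fun hle =>
        absurd (WithBot.coe_le_coe.1 hle.2 (Finset.mem_singleton_self b))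
          (h.notMem_of_isFace h1)⟩
  · intro x hx hcx
    -- all faces through the new vertex lie over a face of the link of the edge
    obtain ⟨β, hβw, hβ, hx1, hx2⟩ : ∃ β ⊆ insert w (σ₀.image π), ¬ σ₀.image π ⊆ β ∧
        x.1 = insert c β ∧ ((eraseVertex c b x).2 = ⊥ ∨ ∃ α ⊂ σ₀, β = α.image π ∧
          (eraseVertex c b x).2 = (α : WithBot _)) := by
      rcases (h.isGluedFace_starring hc).1 hx with ⟨τ, h1, h2, rfl⟩ | ⟨β, h1, h2, rfl⟩ |
        ⟨σ', h1, h2, rfl⟩ | ⟨α, hα, rfl⟩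
      · exact absurd hcx (notMem_of_isFace_base hc h1)
      · exact ⟨β, h1, h2, rfl, Or.inl rfl⟩
      · exact absurd hcx (notMem_of_isFace_base hc (h.labels.isFace h1))
      · exact ⟨α.image π, (Finset.image_subset_image hα.1).trans (Finset.subset_insert _ _),
          h.not_subset_image hα, rfl, Or.inr ⟨α, hα, rfl, congrArg WithBot.some
            (Finset.erase_insert fun hm => hb₀ (hα.1 hm))⟩⟩
    have he : x.1.erase c = β := by rw [hx1, Finset.erase_insert (h.notMem_of_subset hc hβw)]
    have hfil := filter_ssubset β hβ hcσ
    -- Apart from `w`, all vertices of `β` lie in `σ₀.image π`, so `β` is recovered up to `w` from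
    -- the selected part of `σ₀`.
    have him : insert w β = insert w ((σ₀.filter fun v => π v ∈ insert c β).image π) := by
      ext v
      simp only [Finset.mem_insert, Finset.mem_image, Finset.mem_filter]
      constructor
      · rintro (hv | hv)
        · exact Or.inl hv
        · rcases Finset.mem_insert.1 (hβw hv) with hw | hm
          · exact Or.inl hw
          · obtain ⟨u, hu, rfl⟩ := Finset.mem_image.1 hm
            exact Or.inr ⟨u, ⟨hu, Or.inr hv⟩, rfl⟩
      · rintro (hv | ⟨u, ⟨hu, hu' | hu'⟩, rfl⟩)
        · exact Or.inl hv
        · exact absurd (hu' ▸ Finset.mem_image_of_mem π hu) hcσ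
        · exact Or.inr hu'
    have hx1' : (eraseVertex c b x).1 = β := he
    have he' : (insert c β).erase c = β := Finset.erase_insert (h.notMem_of_subset hc hβw)
    simp only [hx1, he']
    refine ⟨?_, ⟨?_, ?_⟩, ⟨?_, ?_⟩, ?_⟩
    · rw [him]
      exact h.isGluedFace_flip.2 (Or.inr (Or.inr ⟨_, hfil, rfl⟩))
    · exact Finset.singleton_subset_iff.2 (Finset.mem_insert_self _ _)
    · exact WithBot.coe_le_coe.2 (Finset.singleton_subset_iff.2 (Finset.mem_insert_self _ _))
    · rw [hx1']
      exact Finset.subset_insert _ _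
    · rcases hx2 with hx2 | ⟨α, hα, rfl, hx2⟩ <;> rw [hx2]
      · exact bot_le
      · refine WithBot.coe_le_coe.2 fun v hv => Finset.mem_insert_of_mem
          (Finset.mem_filter.2 ⟨hα.1 hv, ?_⟩)
        exact Finset.mem_insert_of_mem (Finset.mem_image_of_mem π hv)
    · intro y hy hAy hxy
      obtain ⟨α, hα, rfl⟩ := h.cases_of_edge_le hy hAy
      have hle : β ⊆ insert w (α.image π) := hx1' ▸ hxy.1
      refine ⟨Finset.insert_subset (Finset.mem_insert_self _ _) hle,
        WithBot.coe_le_coe.2 (Finset.insert_subset_insert _ fun v hv => ?_)⟩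
      obtain ⟨hv1, hv2⟩ := Finset.mem_filter.1 hv
      have hvm := Finset.mem_image_of_mem π hv1
      have h3 := Finset.mem_of_mem_insert_of_ne hv2 fun e => hcσ (e ▸ hvm)
      obtain ⟨u, hu, hu'⟩ := Finset.mem_image.1
        (Finset.mem_of_mem_insert_of_ne (hle h3) fun e => h.notMem (e ▸ hvm))
      exact (h.labels _ h.mem).2 (hα.1 hu) hv1 hu' ▸ hu
  · intro u hu hAu
    rcases h.isGluedFace_flip.1 hu with ⟨τ, h1, h2, rfl⟩ | ⟨σ, h1, h2, rfl⟩ | ⟨α, hα, rfl⟩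
    · exact ⟨(h.isGluedFace_starring hc).2 (Or.inl ⟨τ, h1, h2, rfl⟩),
        notMem_of_isFace_base hc h1, fun σ hσ => absurd hσ.symm WithBot.coe_ne_bot⟩
    · refine ⟨(h.isGluedFace_starring hc).2 (Or.inr (Or.inr (Or.inl ⟨σ, h1, h2, rfl⟩))),
        notMem_of_isFace_base hc (h.labels.isFace h1), fun σ' hσ' => ?_⟩
      obtain rfl := WithBot.coe_injective hσ'
      exact h.notMem_of_isFace h1
    · exact absurd ⟨Finset.singleton_subset_iff.2 (Finset.mem_insert_self _ _),
        WithBot.coe_le_coe.2 (Finset.singleton_subset_iff.2 (Finset.mem_insert_self _ _))⟩ hAu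
  · intro u y hu hAu hy huy hAy
    obtain ⟨α, hα, rfl⟩ := h.cases_of_edge_le hy hAy
    rcases h.isGluedFace_flip.1 hu with ⟨τ, h1, h2, rfl⟩ | ⟨σ, h1, h2, rfl⟩ | ⟨α', hα', rfl⟩
    · exact (h.isGluedFace_starring hc).2 (Or.inr (Or.inl ⟨τ, (show τ ⊆ _ from huy.1).trans
        (Finset.insert_subset_insert _ (Finset.image_subset_image hα.1)), h2, rfl⟩))
    · have hσ : σ ⊆ α := (Finset.subset_insert_iff_of_notMem (h.notMem_of_isFace h1)).1
        (WithBot.coe_le_coe.1 huy.2)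
      exact (h.isGluedFace_starring hc).2 (Or.inr (Or.inr (Or.inr
        ⟨σ, lt_of_le_of_lt hσ hα, rfl⟩)))
    · exact absurd ⟨Finset.singleton_subset_iff.2 (Finset.mem_insert_self _ _),
        WithBot.coe_le_coe.2 (Finset.singleton_subset_iff.2 (Finset.mem_insert_self _ _))⟩ hAu

/-- The 2-3 move is a starring followed by a weld. -/
theorem stellarEquiv (h : IsFlip D S π σ₀ w b) (hD : D.faces.Finite) :
    SimplicialPoset.StellarEquiv (glued D S π h.labels) (glued _ _ _ h.labels_flip) := by
  -- Both sides have a starring isomorphic to the same glued complex with the fresh vertex `c`: it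
  -- is entered by a subdivision and left by a weld.
  obtain ⟨c, hc⟩ := ((finite_iff D).1 hD).infinite_compl.nonempty
  obtain ⟨e⟩ := h.starring_iso hc
  obtain ⟨e'⟩ := h.starring_flip_iso hc
  refine (Relation.ReflTransGen.single (.subdivision _ ?_ e)).tail (.weld _ ?_ e')
  · intro he
    exact Finset.singleton_ne_empty w (congrArg (fun x => x.1.1) he)
  · intro he
    exact (h.nonempty.image π).ne_empty (congrArg (fun x => x.1.1) he)

end IsFlip

/-! ### Two glued complexes in familiar form: a starred facet and `a ⋆ (S/≃)`. -/

/-- The starring of a complex at a facet is the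
complex without this facet with the cone over the boundary of a simplex glued to it. -/
theorem stellarEquiv_delete_facet {M : Cplx} {T : Finset ℕ} {n : ℕ} (hT : T ∈ M.faces)
    (hmax : ∀ s ∈ M.faces, T ⊆ s → s = T) {π : ℕ → ℕ}
    (hinj : Set.InjOn π (Finset.range (n + 2) : Set ℕ))
    (him : (Finset.range (n + 2)).image π = T)
    (h : Labels (simplexBoundary n) (delete T M) π) :
    SimplicialPoset.StellarEquiv M.facePoset (glued (delete T M) (simplexBoundary n) π h) := by
  have isFace : ∀ σ, (simplexBoundary n).IsFace σ ↔ σ ⊂ Finset.range (n + 2) := by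
    intro σ
    constructor
    · rintro (rfl | hσ)
      · exact Finset.empty_ssubset.2 (by simp)
      · exact hσ.2
    · intro hσ
      rcases σ.eq_empty_or_nonempty with h0 | h0
      exacts [Or.inl h0, Or.inr ⟨h0, hσ⟩]
  have hns : ∀ σ, (simplexBoundary n).IsFace σ → ¬ T ⊆ σ.image π := by
    intro σ hσ hs
    have hσ' := (isFace σ).1 hσ
    refine hσ'.2 fun v hv => ?_
    obtain ⟨u, hu, he⟩ := Finset.mem_image.1 (hs (him ▸ Finset.mem_image_of_mem π hv))
    exact hinj (hσ'.1 hu) hv he ▸ hu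
  have hTne := nonempty_of_mem hT
  let A : M.facePoset.Face := ⟨T, Or.inr hT⟩
  -- As `T` is maximal, the only possible upper bound in a pair is `T` itself. The simplex `σ` need
  -- not be recorded, for `π` is injective on all vertices and `σ` is determined by its image.
  let Rel : (glued (delete T M) (simplexBoundary n) π h).Face → M.facePoset.Starring A → Prop :=
    fun x z => z.1.1.1 = x.1.1 ∧ ((x.1.2 = ⊥ ∧ z.1.2 = ⊥) ∨ (x.1.2 ≠ ⊥ ∧ z.1.2 = A))
  have iso : Nonempty (M.facePoset.Starring A ≃o
      (glued (delete T M) (simplexBoundary n) π h).Face) := by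
    refine nonempty_orderIso_of_rel Rel ?_ ?_ ?_
    · rintro ⟨⟨τ, σ'⟩, ⟨hσ', hτ⟩ | ⟨σ, hσ, he⟩⟩
      · obtain rfl : σ' = ⊥ := hσ'
        have hτM : M.IsFace τ := hτ.imp id fun h' => h'.1
        refine ⟨⟨(⟨τ, hτM⟩, ⊥), fun hs => ?_, fun σ hσ => absurd hσ.symm WithBot.coe_ne_bot⟩,
          rfl, Or.inl ⟨rfl, rfl⟩⟩
        have hs' : T ⊆ τ := hs
        exact (hτ.mem (hTne.mono hs')).2 hs'
      · obtain ⟨rfl, rfl⟩ := Prod.mk.inj he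
        have hτM : M.IsFace (σ.image π) := (h.isFace hσ).imp id fun h' => h'.1
        refine ⟨⟨(⟨σ.image π, hτM⟩, A), hns σ hσ, fun y hy => ?_⟩,
          rfl, Or.inr ⟨WithBot.coe_ne_bot, rfl⟩⟩
        obtain rfl := WithBot.coe_injective hy
        refine ⟨⟨?_, le_rfl⟩, fun y hy _ => hy.2⟩
        change σ.image π ⊆ T
        rw [← him]
        exact Finset.image_subset_image ((isFace σ).1 hσ).1
    · rintro ⟨⟨⟨τ, hτ⟩, y⟩, hu, hy⟩
      replace hu : ¬ T ⊆ τ := hu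
      have hτD : (delete T M).IsFace τ := hτ.imp id fun h' => ⟨h', hu⟩
      induction y using WithBot.recBotCoe with
      | bot => exact ⟨⟨(τ, ⊥), Or.inl ⟨rfl, hτD⟩⟩, rfl, Or.inl ⟨rfl, rfl⟩⟩
      | coe y =>
        have hmin : Minimal (fun ρ : M.facePoset.Face => ⟨τ, hτ⟩ ≤ ρ ∧ A ≤ ρ) y := hy y rfl
        have hTy : T ⊆ y.1 := hmin.1.2
        have hyT : y.1 = T := hmax _ (IsFace.mem (K := M) y.2 (hTne.mono hTy)) hTy
        have hτT : τ ⊆ (Finset.range (n + 2)).image π := by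
          rw [him, ← hyT]
          exact hmin.1.1
        obtain ⟨σ, hσ, rfl⟩ := Finset.subset_image_iff.1 hτT
        refine ⟨⟨(σ.image π, (σ : WithBot _)), Or.inr ⟨σ, (isFace σ).2 ⟨hσ, fun hs => hu ?_⟩, rfl⟩⟩,
          rfl, Or.inr ⟨WithBot.coe_ne_bot, congrArg WithBot.some (Subtype.ext hyT)⟩⟩
        change T ⊆ σ.image π
        rw [← him]
        exact Finset.image_subset_image hs
    · rintro ⟨x, hx⟩ ⟨⟨u, y⟩, hu, hy⟩ ⟨x', hx'⟩ ⟨⟨u', y'⟩, hu', hy'⟩ ⟨r1, r2⟩ ⟨r1', r2'⟩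
      replace r1 : u.1 = x.1 := r1
      replace r1' : u'.1 = x'.1 := r1'
      replace r2 : (x.2 = ⊥ ∧ y = ⊥) ∨ (x.2 ≠ ⊥ ∧ y = A) := r2
      replace r2' : (x'.2 = ⊥ ∧ y' = ⊥) ∨ (x'.2 ≠ ⊥ ∧ y' = A) := r2'
      change (x.1 ⊆ x'.1 ∧ x.2 ≤ x'.2) ↔ (u.1 ⊆ u'.1 ∧ y ≤ y')
      rw [r1, r1']
      refine and_congr_right fun hxx => ?_
      rcases r2 with ⟨e, rfl⟩ | ⟨e, rfl⟩
      · simp [e]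
      · rcases r2' with ⟨e', rfl⟩ | ⟨e', rfl⟩
        · simp [e', e]
        · refine iff_of_true ?_ le_rfl
          rcases hx with ⟨hx, -⟩ | ⟨σ, hσ, rfl⟩
          · exact absurd hx e
          · rcases hx' with ⟨hx', -⟩ | ⟨σ', hσ', rfl⟩
            · exact absurd hx' e'
            · refine WithBot.coe_le_coe.2 fun v hv => ?_
              obtain ⟨v', hv', he⟩ := Finset.mem_image.1 (hxx (Finset.mem_image_of_mem π hv))
              exact hinj (((isFace _).1 hσ').1 hv') (((isFace _).1 hσ).1 hv) he ▸ hv'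
  obtain ⟨e⟩ := iso
  refine Relation.ReflTransGen.single (.subdivision A (fun he => ?_) e)
  exact hTne.ne_empty (congrArg (fun x => x.1) he)

open Classical in
/-- If all faces of `D` are images of faces of `S`, then `glued D S π` is the cone over `S` with the
vertices of the base identified along `π`. -/
theorem nonempty_glued_iso_coneQuotient {D S : Cplx} {π : ℕ → ℕ} (h : Labels S D π)
    (hD : ∀ s ∈ D.faces, ∃ σ ∈ S.faces, σ.image π = s) {a : ℕ} (ha : a ∉ S.vertices)
    (hr : ∀ s ∈ S.faces, Set.InjOn (Quotient.mk (Setoid.ker π)) (s : Set ℕ)) :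
    Nonempty ((glued D S π h).Face ≃o (S.coneQuotient a (Setoid.ker π) ha hr).Face) := by
  let r := Setoid.ker π
  let f : Quotient r → ℕ := Setoid.kerLift π
  have hf : Function.Injective f := Setoid.kerLift_injective π
  have hfi : ∀ σ : Finset ℕ, (σ.image (Quotient.mk r)).image f = σ.image π := fun σ => by
    rw [Finset.image_image]
    rfl
  have haσ : ∀ σ, S.IsFace σ → a ∉ σ := by
    rintro σ (rfl | hσ)
    exacts [Finset.notMem_empty a, notMem_of_mem_faces ha hσ]
  -- Classes correspond to labels through the injection `f`. The cone marks a base face by `∅` and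
  -- the apex by `{a}`; the glued complex marks them by `⊥` and `∅`.
  let Rel : (S.coneQuotient a r ha hr).Face → (glued D S π h).Face → Prop := fun x y =>
    y.1.1 = x.1.1.image f ∧ ((x.1.2 = ∅ ∧ y.1.2 = ⊥) ∨
      (a ∈ x.1.2 ∧ y.1.2 = ((x.1.2.erase a : Finset ℕ) : WithBot _)))
  refine nonempty_orderIso_of_rel Rel ?_ ?_ ?_
  · rintro ⟨⟨τ, ρ⟩, ⟨h1, h2⟩ | ⟨h1, h2, h3⟩⟩
    · obtain rfl : ρ = ∅ := h2
      refine ⟨⟨(τ.image f, ⊥), Or.inl ⟨rfl, ?_⟩⟩, rfl, Or.inl ⟨rfl, rfl⟩⟩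
      rcases h1 with h1 | ⟨σ, hσ, h1⟩
      · obtain rfl : τ = ∅ := h1
        exact Or.inl (Finset.image_empty f)
      · obtain rfl : σ.image (Quotient.mk r) = τ := h1
        change D.IsFace ((σ.image (Quotient.mk r)).image f)
        rw [hfi]
        exact h.isFace (Or.inr hσ)
    · obtain rfl : τ = (ρ.erase a).image (Quotient.mk r) := h3
      refine ⟨⟨((ρ.erase a).image π, ((ρ.erase a : Finset ℕ) : WithBot _)),
        Or.inr ⟨ρ.erase a, h1.2, rfl⟩⟩, (hfi _).symm, Or.inr ⟨h2, rfl⟩⟩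
  · rintro ⟨⟨τ, ρ⟩, ⟨h1, h2⟩ | ⟨σ, h1, he⟩⟩
    · obtain rfl : ρ = ⊥ := h1
      rcases h2 with h2 | h2
      · obtain rfl : τ = ∅ := h2
        exact ⟨⟨(∅, ∅), Or.inl ⟨Or.inl rfl, rfl⟩⟩, (Finset.image_empty f).symm,
          Or.inl ⟨rfl, rfl⟩⟩
      · obtain ⟨σ, hσ, h3⟩ := hD τ h2
        obtain rfl : σ.image π = τ := h3
        exact ⟨⟨(σ.image (Quotient.mk r), ∅), Or.inl ⟨Or.inr ⟨σ, hσ, rfl⟩, rfl⟩⟩, (hfi σ).symm,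
          Or.inl ⟨rfl, rfl⟩⟩
    · obtain ⟨rfl, rfl⟩ := Prod.mk.inj he
      have e : (insert a σ).erase a = σ := Finset.erase_insert (haσ σ h1)
      refine ⟨⟨(σ.image (Quotient.mk r), insert a σ), Or.inr ⟨⟨Finset.insert_nonempty _ _, ?_⟩,
        Finset.mem_insert_self _ _, ?_⟩⟩, (hfi σ).symm, Or.inr ⟨Finset.mem_insert_self _ _, ?_⟩⟩
      · rw [e]
        exact h1
      · simp only [e]
        rfl
      · exact congrArg WithBot.some e.symm
  · rintro ⟨⟨τ, ρ⟩, hx⟩ ⟨⟨t, s⟩, hy⟩ ⟨⟨τ', ρ'⟩, hx'⟩ ⟨⟨t', s'⟩, hy'⟩ ⟨r1, r2⟩ ⟨r1', r2'⟩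
    replace r1 : t = τ.image f := r1
    replace r1' : t' = τ'.image f := r1'
    replace r2 : (ρ = ∅ ∧ s = ⊥) ∨ (a ∈ ρ ∧ s = ((ρ.erase a : Finset ℕ) : WithBot _)) := r2
    replace r2' : (ρ' = ∅ ∧ s' = ⊥) ∨ (a ∈ ρ' ∧ s' = ((ρ'.erase a : Finset ℕ) : WithBot _)) := r2'
    change (τ ⊆ τ' ∧ ρ ⊆ ρ') ↔ (t ⊆ t' ∧ s ≤ s')
    rw [r1, r1', Finset.image_subset_image_iff hf]
    refine and_congr_right fun _ => ?_
    rcases r2 with ⟨rfl, rfl⟩ | ⟨e, rfl⟩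
    · simp
    · rcases r2' with ⟨rfl, rfl⟩ | ⟨e', rfl⟩
      · simp only [le_bot_iff, WithBot.coe_ne_bot, iff_false]
        exact fun hs => Finset.notMem_empty a (hs e)
      · rw [WithBot.coe_le_coe]
        refine ⟨fun hs => Finset.erase_subset_erase a hs, fun hs v hv => ?_⟩
        by_cases hva : v = a
        · exact hva ▸ e'
        · exact Finset.mem_of_mem_erase (hs (Finset.mem_erase.2 ⟨hva, hv⟩))

/-! ### Unfolding the tetrahedra of `M`. -/

/-- The manifold `M` is stellar equivalent to the complex `D`, a part of `M`, with the cone over a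
stellar sphere `S` glued to it along `π`, where the cone comes from the tetrahedra of `M` that are
not in `D`: each triangle `σ` of `S` is a face of one such tetrahedron `o σ`. -/
structure IsUnfolding (M D S : Cplx) (π : ℕ → ℕ) (o : Finset ℕ → Finset ℕ) : Prop where
  sphere : IsStellarSphere 2 S
  labels : Labels S D π
  le : ∀ s ∈ D.faces, s ∈ M.faces
  owner : ∀ σ ∈ S.faces, σ.card = 3 →
    o σ ∈ M.faces ∧ (o σ).card = 4 ∧ o σ ∉ D.faces ∧ σ.image π ⊆ o σ
  owner_inj : ∀ σ ∈ S.faces, ∀ σ' ∈ S.faces, σ.card = 3 → σ'.card = 3 →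
    σ.image π = σ'.image π → o σ = o σ' → σ = σ'
  owner_surj : ∀ T ∈ M.faces, T.card = 4 → T ∉ D.faces → ∀ t ∈ D.faces, t ⊆ T → t.card = 3 →
    ∃ σ ∈ S.faces, σ.card = 3 ∧ σ.image π = t ∧ o σ = T
  cover : ∀ T ∈ M.faces, T.card = 4 → T ∉ D.faces → ∀ s ∈ D.faces, s ⊆ T →
    ∃ σ ∈ S.faces, σ.image π = s
  equiv : SimplicialPoset.StellarEquiv M.facePoset (glued D S π labels)

theorem IsPseudomanifold.eq_of_subset {n : ℕ} {M : Cplx} (hM : IsPseudomanifold n M)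
    {T s : Finset ℕ} (hn : T.card = n + 1) (hs : s ∈ M.faces) (h : T ⊆ s) : s = T :=
  (Finset.eq_of_subset_of_card_le h (by rw [hn]; exact hM.card_le s hs)).symm

/-- The unfolding starts from a single tetrahedron `T`, which owns all four triangles of the sphere.
-/
theorem exists_isUnfolding {M : Cplx} (hM : IsPseudomanifold 3 M) :
    ∃ D S π o, IsUnfolding M D S π o := by
  obtain ⟨s, hs⟩ := hM.nonempty
  obtain ⟨T, hT, -, hn⟩ := hM.exists_facet s hs
  -- The labels are a bijection from the four vertices of the model tetrahedron onto `T`.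
  obtain ⟨π, hinj, him⟩ : ∃ π : ℕ → ℕ, Set.InjOn π (Finset.range (2 + 2) : Set ℕ) ∧
      (Finset.range (2 + 2)).image π = T := by
    obtain ⟨π, h⟩ := Set.Finite.exists_bijOn_of_encard_eq (Finset.range (2 + 2)).finite_toSet
      (t := (T : Set ℕ)) (by rw [Set.encard_coe_eq_coe_finsetCard, Set.encard_coe_eq_coe_finsetCard,
        hn, Finset.card_range])
    exact ⟨π, h.injOn, Finset.coe_injective (by rw [Finset.coe_image, h.image_eq])⟩
  have hns : ∀ σ ∈ (simplexBoundary 2).faces, ¬ T ⊆ σ.image π := by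
    intro σ hσ hs
    have := Finset.card_le_card hs
    have := Finset.card_image_le (s := σ) (f := π)
    have := (isPseudomanifold_simplexBoundary 2).card_le σ hσ
    omega
  have sub : ∀ σ ∈ (simplexBoundary 2).faces, σ.image π ⊆ T := fun σ hσ => by
    rw [← him]
    exact Finset.image_subset_image hσ.2.1
  have labels : Labels (simplexBoundary 2) (delete T M) π := fun σ hσ =>
    ⟨⟨mem_of_subset hT (sub σ hσ) (hσ.1.image π), hns σ hσ⟩,
      hinj.mono (Finset.coe_subset.2 hσ.2.1)⟩
  have lift : ∀ s ∈ (delete T M).faces, s ⊆ T →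
      ∃ σ ∈ (simplexBoundary 2).faces, σ.image π = s := by
    intro s hs hsT
    rw [← him] at hsT
    obtain ⟨σ, hσ, rfl⟩ := Finset.subset_image_iff.1 hsT
    refine ⟨σ, ⟨Finset.image_nonempty.1 (nonempty_of_mem hs.1), hσ, fun hs' => hs.2 ?_⟩, rfl⟩
    rw [← him]
    exact Finset.image_subset_image hs'
  have eqT : ∀ T' ∈ M.faces, T' ∉ (delete T M).faces → T' = T := fun T' hT' hT'' =>
    hM.eq_of_subset hn hT' (by_contra fun hs => hT'' ⟨hT', hs⟩)
  refine ⟨delete T M, simplexBoundary 2, π, fun _ => T, Relation.ReflTransGen.refl, labels,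
    fun s hs => hs.1, fun σ hσ _ => ⟨hT, hn, fun h => h.2 subset_rfl, sub σ hσ⟩, ?_, ?_, ?_,
    stellarEquiv_delete_facet hT (fun s hs => hM.eq_of_subset hn hs) hinj him labels⟩
  · intro σ hσ σ' hσ' _ _ he _
    have hi := Finset.coe_injective.eq_iff.2 he
    rw [Finset.coe_image, Finset.coe_image] at hi
    exact Finset.coe_injective ((hinj.image_eq_image_iff (Finset.coe_subset.2 hσ.2.1)
      (Finset.coe_subset.2 hσ'.2.1)).1 hi)
  · intro T' hT' _ hT'' t ht htT hc
    obtain rfl := eqT T' hT' hT''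
    obtain ⟨σ, hσ, rfl⟩ := lift t ht htT
    exact ⟨σ, hσ, by rw [← hc, Finset.card_image_of_injOn (labels σ hσ).2], rfl, rfl⟩
  · intro T' hT' _ hT'' t ht htT
    obtain rfl := eqT T' hT' hT''
    exact lift t ht htT

namespace IsUnfolding

variable {M D S : Cplx} {π : ℕ → ℕ} {o : Finset ℕ → Finset ℕ}

theorem isPseudomanifold (h : IsUnfolding M D S π o) : IsPseudomanifold 2 S :=
  (isPseudomanifold_simplexBoundary 2).of_stellarEquiv h.sphere

theorem card_image (h : IsUnfolding M D S π o) {σ : Finset ℕ} (hσ : σ ∈ S.faces) :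
    (σ.image π).card = σ.card :=
  Finset.card_image_of_injOn (h.labels σ hσ).2

/-- A tetrahedron of `D` adjacent to a tetrahedron outside of `D` gives a 2-3 move. -/
theorem exists_isFlip (hM : IsPseudomanifold 3 M) (h : IsUnfolding M D S π o) {T T' : Finset ℕ}
    (hT : T ∈ D.faces) (hTn : T.card = 4) (hT' : T' ∈ M.faces) (hTn' : T'.card = 4)
    (hTD' : T' ∉ D.faces) (hTT' : 3 ≤ (T' ∩ T).card) :
    ∃ σ₀ w b, IsFlip D S π σ₀ w b ∧ σ₀.card = 3 ∧ T = insert w (σ₀.image π) ∧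
      ∀ E ∈ M.faces, E.card = 4 → σ₀.image π ⊆ E → E = T ∨ E ∉ D.faces := by
  have hne : T ≠ T' := fun e => hTD' (e ▸ hT)
  obtain ⟨t, ht, htn⟩ := Finset.exists_subset_card_eq hTT'
  have htT := ht.trans Finset.inter_subset_right
  have htT' := ht.trans Finset.inter_subset_left
  have htD : t ∈ D.faces := mem_of_subset hT htT (Finset.card_pos.1 (by omega))
  obtain ⟨σ₀, hσ₀, hσn, rfl, ho⟩ := h.owner_surj T' hT' hTn' hTD' t htD htT' htn
  obtain ⟨w, hw, rfl⟩ : ∃ w ∉ σ₀.image π, insert w (σ₀.image π) = T :=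
    Finset.covBy_iff_exists_insert.1 (Finset.covBy_iff_card_sdiff_eq_one.2
      ⟨htT, by rw [Finset.card_sdiff_of_subset htT]; omega⟩)
  obtain ⟨b, hb⟩ := ((finite_iff S).1 h.sphere.finite).infinite_compl.nonempty
  -- The triangle lies in the two distinct tetrahedra `T` and `T'`, which therefore exhaust the
  -- tetrahedra of `M` through it.
  have two : ∀ E ∈ M.faces, E.card = 4 → σ₀.image π ⊆ E →
      E = insert w (σ₀.image π) ∨ E = T' := by
    intro E hE hEn htE
    rcases hM.ridge _ htn E hE _ (h.le _ hT) T' hT' hEn hTn hTn' htE htT htT' with e | e | e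
    exacts [Or.inl e, Or.inr e, absurd e hne]
  refine ⟨σ₀, w, b, ⟨h.labels, hσ₀, ?_, hw, hT, ?_, hb⟩, hσn, rfl, ?_⟩
  -- The owner of any other triangle with the same image lies outside `D`, hence is `T'`, the owner
  -- of `σ₀`; then `owner_inj` applies.
  · intro σ hσ hs
    have hc := h.isPseudomanifold.card_le σ hσ
    rw [← h.card_image hσ] at hc
    have he := Finset.eq_of_subset_of_card_le hs (by omega)
    have hn : σ.card = 3 := by rw [← h.card_image hσ, ← he, htn]
    obtain ⟨o1, o2, o3, o4⟩ := h.owner σ hσ hn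
    refine h.owner_inj σ hσ σ₀ hσ₀ hn hσn he.symm ?_
    rw [ho]
    exact (two _ o1 o2 (he ▸ o4)).resolve_left fun e => o3 (e ▸ hT)
  -- A simplex of `D` through the triangle extends to `T` or to `T'`. In the second case it is a
  -- proper face of `T'`, as `T'` is not in `D`, and so it is the triangle itself.
  · intro s hs hts
    obtain ⟨F, hF, hsF, hFn⟩ := hM.exists_facet s (h.le s hs)
    rcases two F hF hFn (hts.trans hsF) with rfl | rfl
    · exact hsF
    · have hlt : s.card < F.card := Finset.card_lt_card
        (Finset.ssubset_iff_subset_ne.2 ⟨hsF, fun e => hTD' (e ▸ hs)⟩)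
      rw [Finset.eq_of_subset_of_card_le hts (by omega)]
      exact Finset.subset_insert _ _
  · intro E hE hEn htE
    rcases two E hE hEn htE with e | rfl
    exacts [Or.inl e, Or.inr hTD']

/-- The three new triangles of the sphere are owned by the tetrahedron `insert w (σ₀.image π)` just
swallowed. The old owner of `σ₀` loses this triangle, but its image leaves `D` as well, so no
triangle of `D` is left without a lift. -/
theorem flip (hMf : M.faces.Finite) (h : IsUnfolding M D S π o)
    {σ₀ : Finset ℕ} {w b : ℕ} (hf : IsFlip D S π σ₀ w b) (hσn : σ₀.card = 3)
    (htwo : ∀ E ∈ M.faces, E.card = 4 → σ₀.image π ⊆ E →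
      E = insert w (σ₀.image π) ∨ E ∉ D.faces) :
    IsUnfolding M (delete (σ₀.image π) D) (subdivide σ₀ b S) (Function.update π b w)
      (fun σ => if b ∈ σ then insert w (σ₀.image π) else o σ) := by
  set T := insert w (σ₀.image π) with hT
  have hTn : T.card = 4 := by
    rw [hT, Finset.card_insert_of_notMem hf.notMem, h.card_image hf.mem, hσn]
  have hTD : T ∈ D.faces := hf.insert_mem
  have hinj₀ := (h.labels _ hf.mem).2
  -- the simplices of the new sphere
  have old : ∀ σ ∈ S.faces, σ ≠ σ₀ → σ ∈ (subdivide σ₀ b S).faces := fun σ hσ hne =>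
    (hf.isFace_subdivide.2 (Or.inl ⟨Or.inr hσ, hne⟩)).mem (nonempty_of_mem hσ)
  have new : ∀ α ⊂ σ₀, insert b α ∈ (subdivide σ₀ b S).faces := fun α hα =>
    (hf.isFace_subdivide.2 (Or.inr ⟨α, hα, rfl⟩)).mem (Finset.insert_nonempty _ _)
  have cases : ∀ σ ∈ (subdivide σ₀ b S).faces,
      (σ ∈ S.faces ∧ b ∉ σ ∧ σ.image (Function.update π b w) = σ.image π) ∨
      ∃ α ⊂ σ₀, σ = insert b α ∧
        σ.image (Function.update π b w) = insert w (α.image π) := by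
    intro σ hσ
    rcases hf.isFace_subdivide.1 (Or.inr hσ) with ⟨h1, -⟩ | ⟨α, hα, rfl⟩
    · exact Or.inl ⟨h1.mem (nonempty_of_mem hσ), hf.notMem_of_isFace h1, hf.image_update h1 w⟩
    · exact Or.inr ⟨α, hα, rfl, hf.image_update_insert hα w⟩
  have outside : ∀ E ∈ M.faces, E.card = 4 → E ∉ (delete (σ₀.image π) D).faces →
      E = T ∨ E ∉ D.faces := by
    intro E hE hEn hED
    by_cases hE' : E ∈ D.faces
    · exact htwo E hE hEn (by_contra fun hs => hED ⟨hE', hs⟩)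
    · exact Or.inr hE'
  have lift : ∀ s, s ⊆ T → ¬ σ₀.image π ⊆ s → w ∈ s →
      ∃ α ⊂ σ₀, (insert b α).image (Function.update π b w) = s := by
    intro s hs hns hw
    have h1 : s.erase w ⊆ σ₀.image π := by
      rw [← Finset.erase_insert hf.notMem]
      exact Finset.erase_subset_erase w hs
    obtain ⟨α, hα, he⟩ := Finset.subset_image_iff.1 h1
    have hα' : α ⊂ σ₀ := ⟨hα, fun hs' => hns ((Finset.image_subset_image hs').trans
      (he ▸ Finset.erase_subset _ _))⟩
    exact ⟨α, hα', by rw [hf.image_update_insert hα', he, Finset.insert_erase hw]⟩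
  refine ⟨?_, hf.labels_flip, fun s hs => h.le s hs.1, ?_, ?_, ?_, ?_, ?_⟩
  · exact Relation.ReflTransGen.head (.weld S σ₀ b hf.mem hf.fresh) h.sphere
  · intro σ hσ hn
    rcases cases σ hσ with ⟨h1, h2, h3⟩ | ⟨α, hα, rfl, h3⟩
    · simp only [h2, if_false, h3]
      obtain ⟨o1, o2, o3, o4⟩ := h.owner σ h1 hn
      exact ⟨o1, o2, fun h' => o3 h'.1, o4⟩
    · simp only [Finset.mem_insert_self, if_true, h3]
      exact ⟨h.le _ hTD, hTn, fun h' => h'.2 (Finset.subset_insert _ _),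
        Finset.insert_subset_insert _ (Finset.image_subset_image hα.1)⟩
  · intro σ hσ σ' hσ' hn hn' he ho
    rcases cases σ hσ with ⟨h1, h2, h3⟩ | ⟨α, hα, rfl, h3⟩ <;>
      rcases cases σ' hσ' with ⟨h1', h2', h3'⟩ | ⟨α', hα', rfl, h3'⟩
    · simp only [h2, h2', if_false] at ho
      exact h.owner_inj σ h1 σ' h1' hn hn' (by rw [← h3, he, h3']) ho
    -- An old and a new triangle cannot have the same owner: old owners are outside `D`, while `T`
    -- was still in `D`.
    · simp only [h2, if_false, Finset.mem_insert_self, if_true] at ho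
      exact absurd (ho ▸ hTD) (h.owner σ h1 hn).2.2.1
    · simp only [h2', if_false, Finset.mem_insert_self, if_true] at ho
      exact absurd (ho ▸ hTD) (h.owner σ' h1' hn').2.2.1
    · rw [h3, h3'] at he
      have hwα : ∀ β ⊂ σ₀, w ∉ β.image π := fun β hβ hm =>
        hf.notMem (Finset.image_subset_image hβ.1 hm)
      have he' : α.image π = α'.image π := by
        rw [← Finset.erase_insert (hwα α hα), he, Finset.erase_insert (hwα α' hα')]
      have hi := Finset.coe_injective.eq_iff.2 he'
      rw [Finset.coe_image, Finset.coe_image] at hi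
      rw [Finset.coe_injective ((hinj₀.image_eq_image_iff (Finset.coe_subset.2 hα.1)
        (Finset.coe_subset.2 hα'.1)).1 hi)]
  · intro E hE hEn hED t ht htE htn
    rcases outside E hE hEn hED with rfl | hED'
    -- The only triangle of `T` that misses `w` is `σ₀.image π`, and it has been deleted.
    · have hw : w ∈ t := by
        by_contra hw
        have hs := (Finset.subset_insert_iff_of_notMem hw).1 htE
        refine ht.2 (Finset.eq_of_subset_of_card_le hs ?_).symm.subset
        rw [h.card_image hf.mem, hσn, htn]
      obtain ⟨α, hα, he⟩ := lift t htE ht.2 hw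
      refine ⟨insert b α, new α hα, ?_, he, by simp⟩
      rw [← htn, ← he, Finset.card_image_of_injOn (hf.labels_flip _ (new α hα)).2]
    · obtain ⟨σ, hσ, hn, rfl, ho⟩ := h.owner_surj E hE hEn hED' t ht.1 htE htn
      have hbσ : b ∉ σ := notMem_of_mem_faces hf.fresh hσ
      refine ⟨σ, old σ hσ ?_, hn, hf.image_update (Or.inr hσ) w, by simp [hbσ, ho]⟩
      rintro rfl
      exact ht.2 subset_rfl
  · intro E hE hEn hED s hs hsE
    rcases outside E hE hEn hED with rfl | hED'
    · by_cases hw : w ∈ s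
      · obtain ⟨α, hα, he⟩ := lift s hsE hs.2 hw
        exact ⟨insert b α, new α hα, he⟩
      · obtain ⟨α, hα, rfl⟩ :=
          Finset.subset_image_iff.1 ((Finset.subset_insert_iff_of_notMem hw).1 hsE)
        have hαS : α ∈ S.faces :=
          mem_of_subset hf.mem hα (Finset.image_nonempty.1 (nonempty_of_mem hs.1))
        refine ⟨α, old α hαS ?_, hf.image_update (Or.inr hαS) w⟩
        rintro rfl
        exact hs.2 subset_rfl
    · obtain ⟨σ, hσ, rfl⟩ := h.cover E hE hEn hED' s hs.1 hsE
      refine ⟨σ, old σ hσ ?_, hf.image_update (Or.inr hσ) w⟩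
      rintro rfl
      exact hs.2 subset_rfl
  · exact h.equiv.trans (hf.stellarEquiv (hMf.subset h.le))

end IsUnfolding

theorem exists_step_of_reflTransGen {α : Type*} {r : α → α → Prop} {p : α → Prop} {x y : α}
    (h : Relation.ReflTransGen r x y) (hx : ¬ p x) (hy : p y) : ∃ u v, r u v ∧ ¬ p u ∧ p v := by
  induction h with
  | refl => exact absurd hy hx
  | @tail v z _ hvz ih =>
    by_cases hv : p v
    · exact ih hv
    · exact ⟨v, z, hvz, hv, hy⟩

/-- All tetrahedra of a pseudomanifold can be unfolded. -/
theorem exists_isUnfolding_complete {M : Cplx} (hM : IsPseudomanifold 3 M)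
    (hMf : M.faces.Finite) :
    ∃ D S π o, IsUnfolding M D S π o ∧ ∀ T ∈ M.faces, T.card = 4 → T ∉ D.faces := by
  suffices ∀ (n : ℕ) (D S : Cplx) (π : ℕ → ℕ) (o : Finset ℕ → Finset ℕ), IsUnfolding M D S π o →
      {T ∈ D.faces | T.card = 4}.ncard = n →
      ∃ D S π o, IsUnfolding M D S π o ∧ ∀ T ∈ M.faces, T.card = 4 → T ∉ D.faces by
    obtain ⟨D, S, π, o, h⟩ := exists_isUnfolding hM
    exact this _ D S π o h rfl
  intro n
  induction n using Nat.strong_induction_on with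
  | _ n ih =>
    intro D S π o h hn
    by_cases hD : ∀ T ∈ M.faces, T.card = 4 → T ∉ D.faces
    · exact ⟨D, S, π, o, h, hD⟩
    · push Not at hD
      obtain ⟨T₁, hT₁, hTn₁, hTD₁⟩ := hD
      -- The owner of any triangle of `S` is a tetrahedron outside `D`. A chain of adjacent
      -- tetrahedra from it to one in `D` has to enter `D` at some step, and there the move is made.
      obtain ⟨s, hs⟩ := h.isPseudomanifold.nonempty
      obtain ⟨σ, hσ, -, hσn⟩ := h.isPseudomanifold.exists_facet s hs
      obtain ⟨o1, o2, o3, -⟩ := h.owner σ hσ hσn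
      obtain ⟨T', T, ⟨⟨hT', hTn'⟩, ⟨-, hTn⟩, hTT'⟩, hTD', hTD⟩ := exists_step_of_reflTransGen
        (p := fun T => T ∈ D.faces) (hM.connected _ o1 _ hT₁ o2 hTn₁) o3 hTD₁
      obtain ⟨σ₀, w, b, hf, hσn, hT, htwo⟩ := h.exists_isFlip hM hTD hTn hT' hTn' hTD' hTT'
      rw [hT] at htwo
      -- The number of tetrahedra in `D` decreases, because `T` contains the deleted triangle.
      refine ih _ ?_ _ _ _ _ (h.flip hMf hf hσn htwo) rfl
      rw [← hn]
      refine Set.ncard_lt_ncard ⟨fun E hE => ⟨hE.1.1, hE.2⟩, fun hs => ?_⟩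
        ((hMf.subset h.le).subset fun E hE => hE.1)
      exact (hs ⟨hTD, hTn⟩).1.2 (hT ▸ Finset.subset_insert _ _)

/-! ### Regularity, the closed case and the theorem. -/

namespace IsUnfolding

variable {M D S : Cplx} {π : ℕ → ℕ} {o : Finset ℕ → Finset ℕ}

theorem mem_generators (h : IsUnfolding M D S π o) {g : Finset ℕ} :
    g ∈ S.generators ↔ g ∈ S.faces ∧ g.card = 3 :=
  h.isPseudomanifold.mem_generators

/-- Equivalence only gives an inclusion of the label sets; both have three elements because `π` is
injective on simplices. -/
theorem image_eq_of_genEquiv (h : IsUnfolding M D S π o) {g p : Finset ℕ}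
    (hg : g ∈ S.generators) (hp : p ∈ S.generators) (hgp : GenEquiv (Setoid.ker π) g p) :
    g.image π = p.image π := by
  obtain ⟨hg, hgn⟩ := h.mem_generators.1 hg
  obtain ⟨hp, hpn⟩ := h.mem_generators.1 hp
  refine Finset.eq_of_subset_of_card_le (fun v hv => ?_) ?_
  · obtain ⟨u, hu, rfl⟩ := Finset.mem_image.1 hv
    obtain ⟨u', hu', he⟩ := hgp.2 u hu
    exact Finset.mem_image.2 ⟨u', hu', (Setoid.ker_def.1 he).symm⟩
  · rw [h.card_image hg, h.card_image hp, hgn, hpn]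

/-- Three triangles of `S` over one triangle of `M` have owners through that triangle, so two of the
owners agree, and `owner_inj` makes the corresponding triangles of `S` equal. -/
theorem regular (hM : IsPseudomanifold 3 M) (h : IsUnfolding M D S π o) :
    S.Regular (Setoid.ker π) := by
  refine ⟨fun g hg u hu v hv huv => ?_, fun g hg p hp q hq hgp hgq => ?_⟩
  · exact (h.labels g hg.1).2 hu hv (Setoid.ker_def.1 huv)
  · have e := h.image_eq_of_genEquiv hg hp hgp
    have e' := h.image_eq_of_genEquiv hg hq hgq
    obtain ⟨hg, hgn⟩ := h.mem_generators.1 hg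
    obtain ⟨hp, hpn⟩ := h.mem_generators.1 hp
    obtain ⟨hq, hqn⟩ := h.mem_generators.1 hq
    obtain ⟨g1, g2, -, g3⟩ := h.owner g hg hgn
    obtain ⟨p1, p2, -, p3⟩ := h.owner p hp hpn
    obtain ⟨q1, q2, -, q3⟩ := h.owner q hq hqn
    rcases hM.ridge (g.image π) (by rw [h.card_image hg, hgn]) _ g1 _ p1 _ q1 g2 p2 q2 g3
      (e ▸ p3) (e' ▸ q3) with ho | ho | ho
    · exact absurd (h.owner_inj g hg p hp hgn hpn e ho).symm hgp.1
    · exact absurd (h.owner_inj g hg q hq hgn hqn e' ho).symm hgq.1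
    · exact h.owner_inj p hp q hq hpn hqn (e.symm.trans e') ho

/-- Closedness yields a second tetrahedron of `M` at the image of `g`. It is outside `D`, so
`owner_surj` gives it a triangle of `S` over the same image, different from `g` because the owners
differ. -/
theorem existsUnique_genEquiv (hM : IsPseudomanifold 3 M) (hfin : M.generators.Finite)
    (hc : M.Closed) (h : IsUnfolding M D S π o)
    (hD : ∀ T ∈ M.faces, T.card = 4 → T ∉ D.faces) {g : Finset ℕ} (hg : g ∈ S.generators) :
    ∃! p, p ∈ S.generators ∧ GenEquiv (Setoid.ker π) g p := by
  obtain ⟨hg', hgn⟩ := h.mem_generators.1 hg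
  obtain ⟨g1, g2, -, g3⟩ := h.owner g hg' hgn
  have hcard : (g.image π).card = 3 := by rw [h.card_image hg', hgn]
  obtain ⟨T, hT, hTn, hs, hne⟩ := hM.exists_ne_of_closed hfin hc hcard g1 g2 g3
  obtain ⟨p, hp, hpn, he, ho⟩ := h.owner_surj T hT hTn (hD T hT hTn) _ (h.labels g hg').1 hs hcard
  have hp' : p ∈ S.generators := h.mem_generators.2 ⟨hp, hpn⟩
  have hgp : GenEquiv (Setoid.ker π) g p := by
    refine ⟨?_, fun v hv => ?_⟩
    · rintro rfl
      exact hne ho.symm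
    · obtain ⟨u, hu, he'⟩ := Finset.mem_image.1 (he ▸ Finset.mem_image_of_mem π hv)
      exact ⟨u, hu, Setoid.ker_def.2 he'.symm⟩
  exact ⟨p, ⟨hp', hgp⟩, fun q hq => (h.regular hM).unique g hg q hq.1 p hp' hq.2 hgp⟩

end IsUnfolding

end Cplx

theorem theorem1 (M : Cplx) (hM : M.IsStellarThreeManifold) (hconn : M.Connected)
    (hfin : M.generators.Finite) :
    ∃ (S : Cplx) (a : ℕ) (r : Setoid ℕ) (hS : S.IsStellarSphere 2) (ha : a ∉ S.vertices)
      (hr : S.Regular r),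
      SimplicialPoset.StellarEquiv M.facePoset
        (S.coneQuotient a r ha (hr.injOn hS.finite)) ∧
      (M.Closed → ∀ g ∈ S.generators, ∃! p, p ∈ S.generators ∧ Cplx.GenEquiv r g p) := by

  have hP := hM.isPseudomanifold hconn
  have hMf := hP.finite hfin
  obtain ⟨D, S, π, o, h, hD⟩ := Cplx.exists_isUnfolding_complete hP hMf
  obtain ⟨a, ha⟩ := ((Cplx.finite_iff S).1 h.sphere.finite).infinite_compl.nonempty
  refine ⟨S, a, Setoid.ker π, h.sphere, ha, h.regular hP, ?_,
    fun hc g hg => h.existsUnique_genEquiv hP hfin hc hD hg⟩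
  -- Each simplex of `D` lies in a tetrahedron of `M`, and by now none of these is in `D`, so
  -- `cover` applies to all of `D`.
  have hcover : ∀ s ∈ D.faces, ∃ σ ∈ S.faces, σ.image π = s := by
    intro s hs
    obtain ⟨T, hT, hsT, hTn⟩ := hP.exists_facet s (h.le s hs)
    exact h.cover T hT hTn (hD T hT hTn) s hs hsT
  obtain ⟨e⟩ := Cplx.nonempty_glued_iso_coneQuotient h.labels hcover ha
    ((h.regular hP).injOn h.sphere.finite)
  exact h.equiv.tail (.rename e)
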